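/- Let $\mathcal X,\mathcal Y$ be finite alphabets, $W=\{W(y|x)\}$ a discrete memoryless channel, $P_X$ a distribution on $\mathcal X$ that is the empirical distribution of some finite sequence, and $R>0$ a rate (all logarithms are natural). For a block length $n$ whose type class $\mathcal T_{P_X}\subseteq\mathcal X^n$ (the sequences with empirical distribution $P_X$) is non-empty, draw $M=\lfloor e^{nR}\rfloor$ codewords $\mathbf x_1,\dots,\mathbf x_M$ independently and uniformly from $\mathcal T_{P_X}$. All joint distributions $Q,\tilde Q$ on $\mathcal X\times\mathcal Y$ below have $X$-marginal $P_X$. Put $$f(Q)=\sum_{x,y}Q(x,y)\log W(y|x)\in[-\infty,0],$$ let $I(Q)$ be the mutual information and $D(Q_{Y|X}\|W|P_X)\in[0,\infty]$ the conditional divergence. Let $g$ be a real-valued continuous function on a compact set $\mathcal G$ of distributions on $\mathcal Y$, and let $g=+\infty$ off $\mathcal G$. The decoder $\phi_g$ puts the codeword $\mathbf x_m$ on the list, when $\mathbf y\in\mathcal Y^n$ is received, iff $f(\hat Q_{\mathbf x_m\mathbf y})\ge g(\hat Q_{\mathbf y})$, where $\hat Q$ denotes empirical distributions. Let $\overline{P_e}$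 be the ensemble average of the average probability that the transmitted codeword is not on the list, $\overline{L}$ the ensemble average of the average number of codewords on the list other than the transmitted one, and $$E_e(R,g)=\liminf_{n\to\infty}-\tfrac1n\log\overline{P_e},\qquad E_l(R,g)=\liminf_{n\to\infty}-\tfrac1n\log\overline{L},$$ where $n$ runs over the block lengths with $\mathcal T_{P_X}\ne\emptyset$, $-\log 0=+\infty$, and a minimum or infimum over the empty set is $+\infty$. (1) If every $Q$ with $g(Q_Y)=f(Q)$ is a limit of distributions $Q'$ with $g(Q'_Y)>f(Q')>-\infty$, then $$E_e(R,g)=\inf_{Q:\ g(Q_Y)\ge f(Q)}D(Q_{Y|X}\|W|P_X),$$ which does not depend on $R$; the infimum is a minimum if $\mathcal G$ is the whole simplex. (2) If every $Q$ with $g(Q_Y)\le f(Q)$ is a limit of distributions $Q'$ with $g(Q'_Y)<f(Q')$ and $Q'_Y$ in the interior of $\mathcal G$ relative to the simplex, then $$E_l(R,g)=\min_{\tilde Q}\ \min_{Q:\ Q_Y=\tilde Q_Y,\ g(Q_Y)\le f(Q)}\bigl\{D(\tilde Q_{Y|X}\|W|P_X)+I(Q)-R\bigr\}.$$ (3) For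 every such $g$, without the conditions in (1) and (2), $E_e(R,g)=\inf_{Q:\ g(Q_Y)>f(Q)}D(Q_{Y|X}\|W|P_X)$, and $E_l(R,g)$ lies between the infimum of $D(\tilde Q_{Y|X}\|W|P_X)+I(Q)-R$ over the pairs with $Q_Y=\tilde Q_Y$, $g(Q_Y)\le f(Q)$, and the infimum over the pairs with $Q_Y=\tilde Q_Y$, $g(Q_Y)<f(Q)$ and $Q_Y$ in the relative interior of $\mathcal G$. -/

import Mathlib

open Filter Topology

noncomputable section

namespace ErasureList

/-! ### Distributions on finite alphabets -/

/-- The `X`-marginal of a joint distribution on `X × Y`. -/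
def margX {X Y : Type*} [Fintype Y] (Q : X × Y → ℝ) : X → ℝ :=
  fun x => ∑ y, Q (x, y)

/-- The `Y`-marginal of a joint distribution on `X × Y`. -/
def margY {X Y : Type*} [Fintype X] (Q : X × Y → ℝ) : Y → ℝ :=
  fun y => ∑ x, Q (x, y)

/-- The conditional distribution of `Y` given `X` (used only where the `X`-marginal is positive). -/
def condYX {X Y : Type*} [Fintype Y] (Q : X × Y → ℝ) : X → Y → ℝ :=
  fun x y => Q (x, y) / margX Q x

/-- The joint distributions on `X × Y` whose `X`-marginal is `P`. -/
def jointWith {X : Type*} (Y : Type*) [Fintype X] [Fintype Y] (P : X → ℝ) : Set (X × Y → ℝ) :=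
  {Q | Q ∈ stdSimplex ℝ (X × Y) ∧ margX Q = P}

open Classical in
/-- The conditional divergence `D(V ‖ W | P) = ∑ₓ P(x) ∑_y V(y|x) log (V(y|x) / W(y|x))`,
which is `+∞` unless `V(·|x)` is absolutely continuous w.r.t. `W(·|x)` wherever `P(x) > 0`. -/
def condDiv {X Y : Type*} [Fintype X] [Fintype Y] (V W : X → Y → ℝ) (P : X → ℝ) : EReal :=
  if ∃ x y, 0 < P x ∧ 0 < V x y ∧ W x y = 0 then ⊤
  else ((∑ x, P x * ∑ y, V x y * Real.log (V x y / W x y) : ℝ) : EReal)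

/-- The mutual information `I(Q)`, in nats. -/
def mutualInfo {X Y : Type*} [Fintype X] [Fintype Y] (Q : X × Y → ℝ) : ℝ :=
  ∑ x, ∑ y, Q (x, y) * Real.log (Q (x, y) / (margX Q x * margY Q y))

open Classical in
/-- The normalized log-likelihood `f(Q) = ∑ Q(x,y) log W(y|x)`, with values in `[-∞, 0]`:
it is `-∞` if `Q` charges a pair `(x, y)` with `W(y|x) = 0`. -/
def logLik {X Y : Type*} [Fintype X] [Fintype Y] (W : X → Y → ℝ) (Q : X × Y → ℝ) : EReal :=
  if ∃ x y, 0 < Q (x, y) ∧ W x y = 0 then ⊥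
  else ((∑ x, ∑ y, Q (x, y) * Real.log (W x y) : ℝ) : EReal)

open Classical in
/-- The empirical distribution of a vector. -/
def empirical {A : Type*} {n : ℕ} (x : Fin n → A) : A → ℝ :=
  fun a => ((Finset.univ.filter fun i => x i = a).card : ℝ) / n

/-- The joint empirical distribution of a pair of vectors. -/
def jointEmpirical {X Y : Type*} {n : ℕ} (x : Fin n → X) (y : Fin n → Y) : X × Y → ℝ :=
  empirical fun i => (x i, y i)

open Classical in
/-- The type class of `P` at block length `n`. -/
def typeClass {X : Type*} [Fintype X] (n : ℕ) (P : X → ℝ) : Finset (Fin n → X) :=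
  Finset.univ.filter fun x => empirical x = P

/-! ### Codes, list decoders and their figures of merit -/

/-- The memoryless channel law `P(y | x) = ∏ᵢ W(yᵢ | xᵢ)`. -/
def channelProb {X Y : Type*} {n : ℕ} (W : X → Y → ℝ) (x : Fin n → X) (y : Fin n → Y) : ℝ :=
  ∏ i, W (x i) (y i)

open Classical in
/-- The average error probability `P_e(C, φ)` of the codebook `C` and the list decoder with
decoding regions `D`. -/
def errorProb {X Y : Type*} [Fintype Y] {n M : ℕ} (W : X → Y → ℝ) (C : Fin M → Fin n → X)
    (D : Fin M → Set (Fin n → Y)) : ℝ :=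
  (1 / (M : ℝ)) * ∑ m, ∑ y, if y ∈ D m then 0 else channelProb W (C m) y

open Classical in
/-- The average number `L(C, φ)` of erroneous codewords on the list. -/
def listSize {X Y : Type*} [Fintype Y] {n M : ℕ} (W : X → Y → ℝ) (C : Fin M → Fin n → X)
    (D : Fin M → Set (Fin n → Y)) : ℝ :=
  ∑ y, (1 / (M : ℝ)) * ∑ m, channelProb W (C m) y *
    ∑ l ∈ Finset.univ.filter (fun l => l ≠ m), if y ∈ D l then 1 else 0

/-- The expectation of `F(C)` when the `M` codewords of `C` are drawn independently and uniformly
from the type class of `P`. -/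
def ensembleAvg {X : Type*} [Fintype X] (P : X → ℝ) (n M : ℕ) (F : (Fin M → Fin n → X) → ℝ) : ℝ :=
  (∑ C ∈ Fintype.piFinset (fun _ : Fin M => typeClass n P), F C) / ((typeClass n P).card : ℝ) ^ M

/-- The number of codewords, `e^{nR}` rounded down to an integer. -/
def codebookSize (R : ℝ) (n : ℕ) : ℕ := ⌊Real.exp (n * R)⌋₊

open Classical in
/-- `-(1/n) log p`, equal to `+∞` if `p = 0`. -/
def normNegLog (n : ℕ) (p : ℝ) : EReal :=
  if p = 0 then ⊤ else ((-(1 / (n : ℝ)) * Real.log p : ℝ) : EReal)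

/-- Block lengths tending to infinity along those `n` for which `P` is the empirical distribution
of some vector of length `n`. -/
def blockLengths {X : Type*} [Fintype X] (P : X → ℝ) : Filter ℕ :=
  atTop ⊓ 𝓟 {n | (typeClass n P).Nonempty}

/-- A rule that assigns decoding regions to each codebook. -/
abbrev ListDecoder (X Y : Type*) : Type _ :=
  (n M : ℕ) → (Fin M → Fin n → X) → Fin M → Set (Fin n → Y)

/-- The random coding error exponent. -/
def errorExponent {X Y : Type*} [Fintype X] [Fintype Y] (W : X → Y → ℝ) (P : X → ℝ) (R : ℝ)
    (φ : ListDecoder X Y) : EReal :=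
  liminf (fun n => normNegLog n (ensembleAvg P n (codebookSize R n)
    fun C => errorProb W C (φ n (codebookSize R n) C))) (blockLengths P)

/-- The random coding list size exponent. -/
def listExponent {X Y : Type*} [Fintype X] [Fintype Y] (W : X → Y → ℝ) (P : X → ℝ) (R : ℝ)
    (φ : ListDecoder X Y) : EReal :=
  liminf (fun n => normNegLog n (ensembleAvg P n (codebookSize R n)
    fun C => listSize W C (φ n (codebookSize R n) C))) (blockLengths P)

/-! ### Decoders with a threshold that depends on the output vector only -/

/-- A threshold function on the distributions on `Y`: continuous on a compact domain. -/
structure OutputThreshold (Y : Type*) [Fintype Y] where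
  /-- the domain on which the threshold is finite -/
  dom : Set (Y → ℝ)
  dom_subset : dom ⊆ stdSimplex ℝ Y
  dom_compact : IsCompact dom
  /-- the values on the domain -/
  val : (Y → ℝ) → ℝ
  val_continuousOn : ContinuousOn val dom

open Classical in
/-- The threshold `g`, infinite off its domain. -/
def OutputThreshold.eval {Y : Type*} [Fintype Y] (g : OutputThreshold Y) (q : Y → ℝ) : EReal :=
  if q ∈ g.dom then ((g.val q : ℝ) : EReal) else ⊤

/-- The decoder `φ_g`: the codeword `x_m` is on the list iff `f(Q̂_{x_m y}) ≥ g(Q̂_y)`. -/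
def thresholdDecoder {X Y : Type*} [Fintype X] [Fintype Y] (W : X → Y → ℝ)
    (g : OutputThreshold Y) : ListDecoder X Y :=
  fun _ _ C m => {y | g.eval (empirical y) ≤ logLik W (jointEmpirical (C m) y)}

/-! ### The single-letter optimization problems -/

/-- `v` is the (attained) minimum of `φ` over `S`, with the convention `min ∅ = +∞`. -/
def IsMinOver {α : Type*} (φ : α → EReal) (S : Set α) (v : EReal) : Prop :=
  IsLeast (φ '' S) v ∨ (S = ∅ ∧ v = ⊤)

/-- `D(Q_{Y|X} ‖ W | P)`. -/
def errorObjective {X Y : Type*} [Fintype X] [Fintype Y] (W : X → Y → ℝ) (P : X → ℝ)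
    (Q : X × Y → ℝ) : EReal :=
  condDiv (condYX Q) W P

/-- The constraint set `{Q : Q_X = P, g(Q_Y) ≥ f(Q)}`. -/
def errorSet {X Y : Type*} [Fintype X] [Fintype Y] (W : X → Y → ℝ) (P : X → ℝ)
    (g : OutputThreshold Y) : Set (X × Y → ℝ) :=
  {Q | Q ∈ jointWith Y P ∧ logLik W Q ≤ g.eval (margY Q)}

/-- The same constraint set with a strict inequality, `{Q : Q_X = P, g(Q_Y) > f(Q)}`. -/
def errorSetStrict {X Y : Type*} [Fintype X] [Fintype Y] (W : X → Y → ℝ) (P : X → ℝ)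
    (g : OutputThreshold Y) : Set (X × Y → ℝ) :=
  {Q | Q ∈ jointWith Y P ∧ logLik W Q < g.eval (margY Q)}

/-- `D(Q̃_{Y|X} ‖ W | P) + I(Q) - R`, as a function of the pair `(Q̃, Q)`. -/
def listObjective {X Y : Type*} [Fintype X] [Fintype Y] (W : X → Y → ℝ) (P : X → ℝ) (R : ℝ)
    (p : (X × Y → ℝ) × (X × Y → ℝ)) : EReal :=
  condDiv (condYX p.1) W P + ((mutualInfo p.2 - R : ℝ) : EReal)

/-- The constraint `Q_X = P, g(Q_Y) ≤ f(Q)` on `Q`. -/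
def listFeasible {X Y : Type*} [Fintype X] [Fintype Y] (W : X → Y → ℝ) (P : X → ℝ)
    (g : OutputThreshold Y) : Set (X × Y → ℝ) :=
  {Q | Q ∈ jointWith Y P ∧ g.eval (margY Q) ≤ logLik W Q}

/-- The strict version of the constraint: `Q_X = P`, `g(Q_Y) < f(Q)`, and `Q_Y` is in the interior
(relative to the simplex) of the domain of `g`. -/
def listFeasibleStrict {X Y : Type*} [Fintype X] [Fintype Y] (W : X → Y → ℝ) (P : X → ℝ)
    (g : OutputThreshold Y) : Set (X × Y → ℝ) :=
  {Q | Q ∈ jointWith Y P ∧ g.dom ∈ 𝓝[stdSimplex ℝ Y] (margY Q) ∧ g.eval (margY Q) < logLik W Q}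

/-- The pairs `(Q̃, Q)` with `Q̃_X = P`, `Q ∈ S` and `Q_Y = Q̃_Y`. -/
def pairsOver {X Y : Type*} [Fintype X] [Fintype Y] (P : X → ℝ) (S : Set (X × Y → ℝ)) :
    Set ((X × Y → ℝ) × (X × Y → ℝ)) :=
  {p | p.1 ∈ jointWith Y P ∧ p.2 ∈ S ∧ margY p.2 = margY p.1}

/-- Ties are nondegenerate for the error event: each `Q` with `g(Q_Y) = f(Q)` is a limit of `Q'`
with `g(Q'_Y) > f(Q') > -∞`. -/
def ErrorRegular {X Y : Type*} [Fintype X] [Fintype Y] (W : X → Y → ℝ) (P : X → ℝ)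
    (g : OutputThreshold Y) : Prop :=
  ∀ Q ∈ jointWith Y P, logLik W Q = g.eval (margY Q) →
    Q ∈ closure {Q' | Q' ∈ errorSetStrict W P g ∧ logLik W Q' ≠ ⊥}

/-- Ties and the boundary of the domain are nondegenerate for the list event: each `Q` that meets
the constraint `g(Q_Y) ≤ f(Q)` is a limit of `Q'` that meet its strict version. -/
def ListRegular {X Y : Type*} [Fintype X] [Fintype Y] (W : X → Y → ℝ) (P : X → ℝ)
    (g : OutputThreshold Y) : Prop :=
  listFeasible W P g ⊆ closure (listFeasibleStrict W P g)

end ErasureList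

end

/-! The proof is the method of types. By symmetry and independence of the codewords, the averaged
error probability is the probability that a uniform input of type `P` and its channel output have a
joint type `Q` with `f(Q) < g(Q_Y)` (`ensembleAvg_errorProb`). The averaged list size is `M - 1`
times a sum over `y` of the output probability times the probability that an independent codeword is
accepted (`ensembleAvg_listSize`). Up to polynomial factors, a joint type `Q` occurs with
probability `exp(-n D)` through the channel and `exp(-n I(Q))` for an independent codeword with `y`
given. There are only polynomially many types, so the infimum over the admissible joint types bounds
the exponents from below (`le_errorExponent`, `le_listExponent`).

For the upper bounds, one rational joint distribution, or a rational pair with a common output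
marginal, is realized exactly at all multiples of a common denominator. A liminf needs only this
subsequence. A real distribution is replaced by rational ones through `ℚ`-linear maps `ℝ → ℚ` that
fix `1` and converge pointwise to the identity (`exists_rat_linear_approx`). They preserve
normalization, the rational marginal `P`, equality of output marginals and zero entries exactly. The
constraint must survive the perturbation: `f < g` does, because `g` extended by `+∞` is lower
semicontinuous, whereas `g < f` does only in the interior of the domain. Rejection is itself the
strict inequality, so the error exponent is determined without further conditions, while acceptance
`g ≤ f` leaves a gap.

The regularity conditions identify the strict and nonstrict infima by continuity: where finite, both
objectives are continuous expressions in entropies and a linear term. In the list problem the second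
distribution must follow the perturbed output marginal, which is `exists_seq_margY_eq`. Attainment
is compactness (`isMinOver_biInf`). -/

noncomputable section

namespace ErasureList

open Classical

variable {A X Y : Type*} {n : ℕ}

/-! ### The method of types -/

/-- The number of occurrences of each letter in a vector. -/
def letterCount (x : Fin n → A) (a : A) : ℕ := (Finset.univ.filter fun i => x i = a).card

lemma empirical_apply (x : Fin n → A) (a : A) : empirical x a = (letterCount x a : ℝ) / n := rfl

lemma letterCount_eq (x : Fin n → A) (a : A) : (letterCount x a : ℝ) = n * empirical x a := by
  rcases Nat.eq_zero_or_pos n with rfl | hn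
  · simp [letterCount]
  · rw [empirical_apply]
    field_simp

lemma empirical_eq_iff (x y : Fin n → A) :
    empirical x = empirical y ↔ ∀ a, letterCount x a = letterCount y a := by
  constructor
  · intro h a
    have := letterCount_eq x a
    rw [h, ← letterCount_eq y a] at this
    exact_mod_cast this
  · intro h
    ext a
    rw [empirical_apply, empirical_apply, h]

lemma sum_letterCount [Fintype A] (x : Fin n → A) : ∑ a, letterCount x a = n := by
  have := Finset.card_eq_sum_card_fiberwise (f := x) (s := Finset.univ) (t := Finset.univ)
    (fun _ _ => Finset.mem_coe.2 (Finset.mem_univ _))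
  simpa [letterCount] using this.symm

lemma mem_typeClass [Fintype A] {x : Fin n → A} {P : A → ℝ} :
    x ∈ typeClass n P ↔ empirical x = P := by
  simp [typeClass]

lemma letterCount_comp_perm (x : Fin n → A) (σ : Equiv.Perm (Fin n)) (a : A) :
    letterCount (x ∘ σ) a = letterCount x a := by
  unfold letterCount
  apply Finset.card_bij (fun i _ => σ i)
  · intro i hi; simpa using hi
  · intro i _ j _ h; exact σ.injective h
  · intro i hi
    exact ⟨σ.symm i, by simpa using hi, by simp⟩

lemma empirical_comp_perm (x : Fin n → A) (σ : Equiv.Perm (Fin n)) :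
    empirical (x ∘ σ) = empirical x :=
  (empirical_eq_iff _ _).2 (letterCount_comp_perm x σ)

lemma exists_perm_of_empirical_eq {x y : Fin n → A} (h : empirical x = empirical y) :
    ∃ σ : Equiv.Perm (Fin n), y ∘ σ = x := by
  rw [empirical_eq_iff] at h
  have e : ∀ a, Nonempty ({i // x i = a} ≃ {i // y i = a}) := fun a => by
    rw [← Fintype.card_eq, Fintype.card_subtype, Fintype.card_subtype]
    exact h a
  exact ⟨Equiv.ofFiberEquiv fun a => (e a).some, funext fun i => Equiv.ofFiberEquiv_map _ i⟩

/-- Orbit counting for the permutations of positions: the type class is the orbit of `x`, and the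
stabilizer permutes positions carrying equal letters. -/
lemma card_typeClass_mul [Fintype A] (x : Fin n → A) :
    (typeClass n (empirical x)).card * ∏ a, (letterCount x a).factorial = n.factorial := by
  have h1 : Fintype.card (Equiv.Perm (Fin n)) = n.factorial := by
    rw [Fintype.card_perm, Fintype.card_fin]
  have h2 : ∀ z ∈ typeClass n (empirical x),
      (Finset.univ.filter fun σ : Equiv.Perm (Fin n) => x ∘ σ = z).card =
        ∏ a, (letterCount x a).factorial := by
    intro z hz
    obtain ⟨τ, rfl⟩ := exists_perm_of_empirical_eq (mem_typeClass.1 hz)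
    have h3 := DomMulAct.stabilizer_card x
    simp only [Fintype.card_subtype] at h3
    unfold letterCount
    rw [← h3]
    -- The permutations carrying `x` to `x ∘ τ` form a coset of the stabilizer of `x`.
    apply Finset.card_bij (fun σ _ => σ * τ⁻¹)
    · intro σ hσ
      simp only [Finset.mem_filter, Finset.mem_univ, true_and] at hσ ⊢
      funext i
      have := congrFun hσ (τ⁻¹ i)
      simpa using this
    · intro σ _ σ' _ h
      exact mul_right_cancel h
    · intro σ hσ
      refine ⟨σ * τ, ?_, by simp⟩
      simp only [Finset.mem_filter, Finset.mem_univ, true_and] at hσ ⊢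
      funext i
      exact congrFun hσ (τ i)
  have h4 := Finset.card_eq_sum_card_fiberwise
    (f := fun σ : Equiv.Perm (Fin n) => x ∘ σ) (s := Finset.univ)
    (t := typeClass n (empirical x))
    (fun σ _ => Finset.mem_coe.2 (mem_typeClass.2 (empirical_comp_perm x σ)))
  rw [Finset.sum_congr rfl h2, Finset.sum_const, smul_eq_mul, Finset.card_univ, h1] at h4
  exact h4.symm

lemma card_typeClass [Fintype A] (x : Fin n → A) :
    (typeClass n (empirical x)).card = Nat.multinomial Finset.univ (letterCount x) := by
  have h := Nat.multinomial_spec Finset.univ (letterCount x)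
  rw [sum_letterCount, ← card_typeClass_mul x, mul_comm] at h
  exact (Nat.eq_of_mul_eq_mul_right (Finset.prod_pos fun a _ => Nat.factorial_pos _) h).symm

/-- The quotient of the two factorials has `|m - k|` factors, all at least `k` if `k ≤ m` and all at
most `k` if `m ≤ k`. -/
lemma factorial_mul_pow_le (k m : ℕ) : k.factorial * k ^ m ≤ m.factorial * k ^ k := by
  rcases le_total k m with h | h
  · calc k.factorial * k ^ m = (k.factorial * k ^ (m - k)) * k ^ k := by
          rw [mul_assoc, ← pow_add, Nat.sub_add_cancel h]
      _ ≤ _ := Nat.mul_le_mul_right _ (Nat.factorial_mul_pow_sub_le_factorial h)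
  · have : k.factorial ≤ m.factorial * k ^ (k - m) := by
      rw [← Nat.factorial_mul_descFactorial (Nat.sub_le k m), Nat.sub_sub_self h]
      exact Nat.mul_le_mul_left _ (Nat.descFactorial_le_pow _ _)
    calc k.factorial * k ^ m ≤ (m.factorial * k ^ (k - m)) * k ^ m := Nat.mul_le_mul_right _ this
      _ = _ := by rw [mul_assoc, ← pow_add, Nat.sub_add_cancel h]

/-- For i.i.d. letters with probabilities proportional to `k`, the most likely type is `k` itself;
the comparison is made letter by letter. -/
lemma multinomial_mul_prod_le [Fintype A] (k m : A → ℕ) (h : ∑ a, k a = ∑ a, m a) :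
    Nat.multinomial Finset.univ m * ∏ a, k a ^ m a ≤
      Nat.multinomial Finset.univ k * ∏ a, k a ^ k a := by
  have hk := Nat.multinomial_spec Finset.univ k
  have hm := Nat.multinomial_spec Finset.univ m
  have h1 : (∏ a, (k a).factorial) * ∏ a, k a ^ m a ≤ (∏ a, (m a).factorial) * ∏ a, k a ^ k a := by
    rw [← Finset.prod_mul_distrib, ← Finset.prod_mul_distrib]
    exact Finset.prod_le_prod' fun a _ => factorial_mul_pow_le _ _
  have hpos : 0 < (∏ a, (k a).factorial) * (∏ a, (m a).factorial) :=
    Nat.mul_pos (Finset.prod_pos fun a _ => Nat.factorial_pos _)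
      (Finset.prod_pos fun a _ => Nat.factorial_pos _)
  refine Nat.le_of_mul_le_mul_left ?_ hpos
  calc _ = ((∏ a, (m a).factorial) * Nat.multinomial Finset.univ m) *
        ((∏ a, (k a).factorial) * ∏ a, k a ^ m a) := by ring
    _ ≤ ((∏ a, (k a).factorial) * Nat.multinomial Finset.univ k) *
        ((∏ a, (m a).factorial) * ∏ a, k a ^ k a) := by
        rw [hk, hm, h]
        exact Nat.mul_le_mul_left _ h1
    _ = _ := by ring

/-- The left side is one term of the multinomial expansion of `n ^ n = (∑ a, letterCount x a) ^ n`.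
-/
lemma card_typeClass_mul_prod_le [Fintype A] (x : Fin n → A) :
    (typeClass n (empirical x)).card * ∏ a, letterCount x a ^ letterCount x a ≤ n ^ n := by
  have h := Finset.sum_pow_eq_sum_piAntidiag Finset.univ (letterCount x) n
  rw [sum_letterCount] at h
  rw [h, card_typeClass]
  exact Finset.single_le_sum
    (f := fun k : A → ℕ => Nat.multinomial Finset.univ k * ∏ a, letterCount x a ^ k a)
    (fun _ _ => Nat.zero_le _) (by simp [sum_letterCount])

lemma card_piAntidiag_univ_le [Fintype A] (n : ℕ) :
    (Finset.piAntidiag (Finset.univ : Finset A) n).card ≤ (n + 1) ^ Fintype.card A := by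
  calc _ ≤ (Fintype.piFinset fun _ : A => Finset.range (n + 1)).card := by
        apply Finset.card_le_card
        intro k hk
        simp only [Finset.mem_piAntidiag] at hk
        simp only [Fintype.mem_piFinset, Finset.mem_range]
        intro a
        have := Finset.single_le_sum (f := k) (fun _ _ => Nat.zero_le _) (Finset.mem_univ a)
        exact Nat.lt_succ_of_le (this.trans_eq hk.1)
    _ = _ := by simp

/-- The same expansion has at most `(n + 1) ^ |A|` terms, and the term of the type of `x` is the
largest. -/
lemma pow_le_card_typeClass_mul_prod [Fintype A] (x : Fin n → A) :
    n ^ n ≤ (n + 1) ^ Fintype.card A *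
      ((typeClass n (empirical x)).card * ∏ a, letterCount x a ^ letterCount x a) := by
  have h := Finset.sum_pow_eq_sum_piAntidiag Finset.univ (letterCount x) n
  rw [sum_letterCount] at h
  rw [h, card_typeClass]
  refine (Finset.sum_le_card_nsmul _ _ _ fun k hk => ?_).trans
    (Nat.mul_le_mul_right _ (card_piAntidiag_univ_le n))
  simp only [Finset.mem_piAntidiag] at hk
  exact multinomial_mul_prod_le _ _ (by rw [sum_letterCount, hk.1])

/-! ### Sizes of type classes in terms of entropy, and the number of types -/

/-- The Shannon entropy, in nats. -/
def entropy [Fintype A] (Q : A → ℝ) : ℝ := ∑ a, Real.negMulLog (Q a)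

lemma continuous_entropy [Fintype A] : Continuous (entropy : (A → ℝ) → ℝ) := by
  unfold entropy
  exact continuous_finsetSum _ fun a _ => Real.continuous_negMulLog.comp (continuous_apply a)

lemma prod_letterCount_pow [Fintype A] (hn : 0 < n) (x : Fin n → A) :
    ((∏ a, letterCount x a ^ letterCount x a : ℕ) : ℝ) * Real.exp (n * entropy (empirical x)) =
      (n : ℝ) ^ n := by
  have hn' : (n : ℝ) ≠ 0 := by positivity
  have h1 : (n : ℝ) ^ n = ∏ a, (n : ℝ) ^ letterCount x a := by
    rw [Finset.prod_pow_eq_pow_sum, sum_letterCount]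
  rw [h1, entropy, Finset.mul_sum, Real.exp_sum]
  push_cast
  rw [← Finset.prod_mul_distrib]
  refine Finset.prod_congr rfl fun a _ => ?_
  -- An absent letter contributes `0 ^ 0 = 1` on one side and `0 log 0 = 0` on the other.
  rcases Nat.eq_zero_or_pos (letterCount x a) with h0 | h0
  · simp [empirical_apply, h0]
  · have hk : (0 : ℝ) < letterCount x a := by exact_mod_cast h0
    have : (n : ℝ) * Real.negMulLog (empirical x a) =
        (letterCount x a : ℝ) * Real.log (n / letterCount x a) := by
      rw [empirical_apply, Real.negMulLog, ← inv_div, Real.log_inv]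
      field_simp
    rw [this, mul_comm (letterCount x a : ℝ), ← Real.rpow_def_of_pos (by positivity),
      Real.rpow_natCast, ← mul_pow, mul_div_cancel₀ _ hk.ne']

lemma prod_letterCount_pow_pos [Fintype A] (x : Fin n → A) :
    0 < ((∏ a, letterCount x a ^ letterCount x a : ℕ) : ℝ) := by
  have : 0 < ∏ a, letterCount x a ^ letterCount x a := Finset.prod_pos fun a _ => by
    rcases Nat.eq_zero_or_pos (letterCount x a) with h0 | h0
    · simp [h0]
    · positivity
  exact_mod_cast this

lemma card_typeClass_le [Fintype A] (hn : 0 < n) (x : Fin n → A) :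
    ((typeClass n (empirical x)).card : ℝ) ≤ Real.exp (n * entropy (empirical x)) := by
  have h : ((typeClass n (empirical x)).card : ℝ) *
      ((∏ a, letterCount x a ^ letterCount x a : ℕ) : ℝ) ≤ (n : ℝ) ^ n := by
    exact_mod_cast card_typeClass_mul_prod_le x
  rw [← prod_letterCount_pow hn x, mul_comm] at h
  exact le_of_mul_le_mul_left h (prod_letterCount_pow_pos x)

lemma le_card_typeClass [Fintype A] (hn : 0 < n) (x : Fin n → A) :
    Real.exp (n * entropy (empirical x)) ≤
      ((n : ℝ) + 1) ^ Fintype.card A * ((typeClass n (empirical x)).card : ℝ) := by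
  have h : (n : ℝ) ^ n ≤ ((n : ℝ) + 1) ^ Fintype.card A * (((typeClass n (empirical x)).card : ℝ) *
      ((∏ a, letterCount x a ^ letterCount x a : ℕ) : ℝ)) := by
    exact_mod_cast pow_le_card_typeClass_mul_prod x
  rw [← prod_letterCount_pow hn x] at h
  refine le_of_mul_le_mul_left (h.trans_eq ?_) (prod_letterCount_pow_pos x)
  ring

lemma card_typeClass_pos [Fintype A] (x : Fin n → A) :
    (0 : ℝ) < (typeClass n (empirical x)).card := by
  have : (typeClass n (empirical x)).Nonempty := ⟨x, mem_typeClass.2 rfl⟩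
  exact_mod_cast this.card_pos

lemma card_image_empirical_le [Fintype A] :
    ((Finset.univ.image (empirical : (Fin n → A) → A → ℝ)).card : ℝ) ≤
      ((n : ℝ) + 1) ^ Fintype.card A := by
  have : (Finset.univ.image (empirical : (Fin n → A) → A → ℝ)).card ≤
      (Finset.piAntidiag (Finset.univ : Finset A) n).card := by
    calc _ ≤ ((Finset.piAntidiag (Finset.univ : Finset A) n).image
          fun k a => (k a : ℝ) / n).card := by
          apply Finset.card_le_card
          intro q hq
          obtain ⟨x, -, rfl⟩ := Finset.mem_image.1 hq
          exact Finset.mem_image.2 ⟨letterCount x, by simp [sum_letterCount], rfl⟩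
      _ ≤ _ := Finset.card_image_le
  exact_mod_cast this.trans (card_piAntidiag_univ_le n)

/-- Each fiber contributes total weight one. Weighting vectors by the inverse size of their type
class thus counts types, so that the later bounds can sum over vectors instead of types. -/
lemma sum_inv_card_fiber {α β : Type*} [Fintype α] [DecidableEq β] (φ : α → β) :
    ∑ z, (1 : ℝ) / ((Finset.univ.filter fun z' => φ z' = φ z).card : ℝ) =
      (Finset.univ.image φ).card := by
  rw [← Finset.sum_fiberwise_of_maps_to (s := Finset.univ) (t := Finset.univ.image φ) (g := φ)
    (fun z _ => Finset.mem_image_of_mem φ (Finset.mem_univ z))]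
  rw [Finset.card_eq_sum_ones, Nat.cast_sum]
  refine Finset.sum_congr rfl fun b hb => ?_
  obtain ⟨z, -, rfl⟩ := Finset.mem_image.1 hb
  rw [Finset.sum_congr rfl (g := fun _ =>
    (1 : ℝ) / ((Finset.univ.filter fun z' => φ z' = φ z).card : ℝ))
    (fun w hw => by rw [(Finset.mem_filter.1 hw).2])]
  have : (0 : ℝ) < ((Finset.univ.filter fun z' => φ z' = φ z).card : ℝ) := by
    exact_mod_cast Finset.card_pos.2 ⟨z, by simp⟩
  rw [Finset.sum_const, nsmul_eq_mul]
  field_simp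
  simp

lemma sum_inv_card_typeClass_le [Fintype A] :
    ∑ z : Fin n → A, (1 : ℝ) / ((typeClass n (empirical z)).card : ℝ) ≤
      ((n : ℝ) + 1) ^ Fintype.card A := by
  refine le_trans (le_of_eq ?_) card_image_empirical_le
  rw [← sum_inv_card_fiber (empirical : (Fin n → A) → A → ℝ)]
  exact Finset.sum_congr rfl fun z _ => by congr

lemma letterCount_pair_sum_left [Fintype X] (x : Fin n → X) (y : Fin n → Y) (b : Y) :
    ∑ a, letterCount (fun i => (x i, y i)) (a, b) = letterCount y b := by
  unfold letterCount
  rw [Finset.card_eq_sum_card_fiberwise (f := x) (s := Finset.univ.filter fun i => y i = b)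
    (t := Finset.univ) (fun _ _ => Finset.mem_coe.2 (Finset.mem_univ _))]
  refine Finset.sum_congr rfl fun a _ => ?_
  rw [Finset.filter_filter]
  congr 1
  ext i
  simp [and_comm]

lemma letterCount_pair_sum_right [Fintype Y] (x : Fin n → X) (y : Fin n → Y) (a : X) :
    ∑ b, letterCount (fun i => (x i, y i)) (a, b) = letterCount x a := by
  unfold letterCount
  rw [Finset.card_eq_sum_card_fiberwise (f := y) (s := Finset.univ.filter fun i => x i = a)
    (t := Finset.univ) (fun _ _ => Finset.mem_coe.2 (Finset.mem_univ _))]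
  refine Finset.sum_congr rfl fun b _ => ?_
  rw [Finset.filter_filter]
  congr 1
  ext i
  simp

lemma margY_jointEmpirical [Fintype X] (x : Fin n → X) (y : Fin n → Y) :
    margY (jointEmpirical x y) = empirical y := by
  ext b
  simp only [margY, jointEmpirical, empirical_apply]
  rw [← Finset.sum_div, ← letterCount_pair_sum_left x y b]
  push_cast
  rfl

lemma margX_jointEmpirical [Fintype Y] (x : Fin n → X) (y : Fin n → Y) :
    margX (jointEmpirical x y) = empirical x := by
  ext a
  simp only [margX, jointEmpirical, empirical_apply]
  rw [← Finset.sum_div, ← letterCount_pair_sum_right x y a]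
  push_cast
  rfl

/-! ### Conditional type classes given an output vector -/

section Joint

variable [Fintype X] [Fintype Y]

/-- The number of input vectors that have joint type `Q` with a given output vector. -/
def condCount (Q : X × Y → ℝ) (y : Fin n → Y) : ℕ :=
  (Finset.univ.filter fun x : Fin n → X => jointEmpirical x y = Q).card

/-- A permutation of positions that carries one output vector to the other also carries the inputs,
and it preserves joint types. -/
lemma condCount_congr (Q : X × Y → ℝ) {y y' : Fin n → Y} (h : empirical y = empirical y') :
    condCount Q y = condCount Q y' := by
  obtain ⟨σ, rfl⟩ := exists_perm_of_empirical_eq h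
  unfold condCount
  apply Finset.card_bij (fun x _ => x ∘ σ.symm)
  · intro x hx
    simp only [Finset.mem_filter, Finset.mem_univ, true_and] at hx ⊢
    rw [← hx]
    unfold jointEmpirical
    rw [← empirical_comp_perm (fun i => ((x ∘ σ.symm) i, y' i)) σ]
    congr 1
    funext i
    simp
  · intro x _ x' _ hxx
    funext i
    simpa using congrFun hxx (σ i)
  · intro x hx
    refine ⟨x ∘ σ, ?_, by funext i; simp⟩
    simp only [Finset.mem_filter, Finset.mem_univ, true_and] at hx ⊢
    rw [← hx]
    exact empirical_comp_perm (fun i => (x i, y' i)) σ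

/-- Project the joint type class to its output components: all fibers over the type class of `Q_Y`
have the same size. -/
lemma condCount_mul_card (Q : X × Y → ℝ) (y : Fin n → Y) (hy : empirical y = margY Q) :
    condCount Q y * (typeClass n (margY Q)).card = (typeClass n Q).card := by
  have h := Finset.card_eq_sum_card_fiberwise (f := fun (z : Fin n → X × Y) i => (z i).2)
    (s := typeClass n Q) (t := typeClass n (margY Q)) (by
      intro z hz
      have hz' := mem_typeClass.1 (Finset.mem_coe.1 hz)
      refine Finset.mem_coe.2 (mem_typeClass.2 ?_)
      rw [← hz', ← margY_jointEmpirical (fun i => (z i).1)]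
      rfl)
  rw [h, Finset.sum_congr rfl (g := fun _ => condCount Q y), Finset.sum_const, smul_eq_mul,
    mul_comm]
  intro y' hy'
  rw [condCount_congr Q (hy.trans (mem_typeClass.1 hy').symm)]
  unfold condCount
  apply Finset.card_bij (fun z _ i => (z i).1)
  · intro z hz
    simp only [Finset.mem_filter, Finset.mem_univ, true_and, mem_typeClass] at hz ⊢
    rw [← hz.1, ← hz.2]
    rfl
  · intro z hz z' hz' hzz
    simp only [Finset.mem_filter] at hz hz'
    funext i
    exact Prod.ext (congrFun hzz i) ((congrFun hz.2 i).trans (congrFun hz'.2 i).symm)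
  · intro x hx
    simp only [Finset.mem_filter, Finset.mem_univ, true_and] at hx
    exact ⟨fun i => (x i, y' i), by simpa [mem_typeClass, jointEmpirical] using hx, rfl⟩

lemma condCount_jointEmpirical (x : Fin n → X) (y : Fin n → Y) :
    (condCount (jointEmpirical x y) y : ℝ) * (typeClass n (empirical y)).card =
      (typeClass n (jointEmpirical x y)).card := by
  have := condCount_mul_card (jointEmpirical x y) y (margY_jointEmpirical x y).symm
  rw [margY_jointEmpirical] at this
  exact_mod_cast this

/-- Each ratio is the inverse size of a conditional type class, so the sum counts the joint types
compatible with `y`. -/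
lemma sum_card_ratio_le (y : Fin n → Y) :
    ∑ x : Fin n → X, ((typeClass n (empirical y)).card : ℝ) /
      (typeClass n (jointEmpirical x y)).card ≤ ((n : ℝ) + 1) ^ Fintype.card (X × Y) := by
  have h : ∀ x : Fin n → X, ((typeClass n (empirical y)).card : ℝ) /
      (typeClass n (jointEmpirical x y)).card =
        1 / ((Finset.univ.filter fun x' => jointEmpirical x' y = jointEmpirical x y).card : ℝ) := by
    intro x
    have h1 := card_typeClass_pos y
    rw [← condCount_jointEmpirical, condCount, one_div, div_mul_cancel_right₀ h1.ne']
  rw [Finset.sum_congr rfl fun x _ => h x]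
  refine (sum_inv_card_fiber fun x => jointEmpirical x y).le.trans ?_
  refine le_trans ?_ (card_image_empirical_le (n := n))
  have : (Finset.univ.image fun x : Fin n → X => jointEmpirical x y).card ≤
      (Finset.univ.image (empirical : (Fin n → X × Y) → X × Y → ℝ)).card := by
    apply Finset.card_le_card
    intro q hq
    obtain ⟨x, -, rfl⟩ := Finset.mem_image.1 hq
    exact Finset.mem_image_of_mem _ (Finset.mem_univ _)
  exact_mod_cast this

end Joint

/-! ### Single-letter formulas -/

lemma continuous_margY [Fintype X] : Continuous (margY : (X × Y → ℝ) → Y → ℝ) := by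
  unfold margY
  fun_prop

lemma continuous_margX [Fintype Y] : Continuous (margX : (X × Y → ℝ) → X → ℝ) := by
  unfold margX
  fun_prop

lemma le_margX [Fintype Y] {Q : X × Y → ℝ} (hQ : ∀ z, 0 ≤ Q z) (x : X) (y : Y) : Q (x, y) ≤ margX Q x :=
  Finset.single_le_sum (f := fun y => Q (x, y)) (fun _ _ => hQ _) (Finset.mem_univ y)

lemma le_margY [Fintype X] {Q : X × Y → ℝ} (hQ : ∀ z, 0 ≤ Q z) (x : X) (y : Y) : Q (x, y) ≤ margY Q y :=
  Finset.single_le_sum (f := fun x => Q (x, y)) (fun _ _ => hQ _) (Finset.mem_univ x)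

lemma channelProb_nonneg {W : X → Y → ℝ} (hW : ∀ x y, 0 ≤ W x y) (x : Fin n → X) (y : Fin n → Y) :
    0 ≤ channelProb W x y := Finset.prod_nonneg fun _ _ => hW _ _

section SingleLetter

variable [Fintype X] [Fintype Y]

/-- The real-valued part of the normalized log-likelihood. -/
def logLikReal (W : X → Y → ℝ) (Q : X × Y → ℝ) : ℝ := ∑ x, ∑ y, Q (x, y) * Real.log (W x y)

/-- The conditional divergence of a distribution that charges only pairs with `W(y|x) > 0`,
in terms of entropies. -/
def condDivReal (W : X → Y → ℝ) (P : X → ℝ) (Q : X × Y → ℝ) : ℝ :=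
  entropy P - entropy Q - logLikReal W Q

lemma continuous_logLikReal (W : X → Y → ℝ) : Continuous (logLikReal W) := by
  unfold logLikReal
  fun_prop

lemma continuous_condDivReal (W : X → Y → ℝ) (P : X → ℝ) : Continuous (condDivReal W P) :=
  (continuous_const.sub continuous_entropy).sub (continuous_logLikReal W)

lemma logLik_eq_bot_iff {W : X → Y → ℝ} {Q : X × Y → ℝ} :
    logLik W Q = ⊥ ↔ ∃ x y, 0 < Q (x, y) ∧ W x y = 0 := by
  unfold logLik
  split_ifs with h
  · simp [h]
  · simp only [h, iff_false]
    exact EReal.coe_ne_bot _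

lemma logLik_ne_bot_iff {W : X → Y → ℝ} {Q : X × Y → ℝ} :
    logLik W Q ≠ ⊥ ↔ ∀ x y, W x y = 0 → Q (x, y) ≤ 0 := by
  rw [Ne, logLik_eq_bot_iff]
  push Not
  exact ⟨fun h x y hw => not_lt.1 fun hq => h x y hq hw,
    fun h x y hq hw => absurd (h x y hw) (not_le.2 hq)⟩

lemma logLik_of_ne_bot {W : X → Y → ℝ} {Q : X × Y → ℝ} (h : logLik W Q ≠ ⊥) :
    logLik W Q = (logLikReal W Q : ℝ) := by
  rw [Ne, logLik_eq_bot_iff] at h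
  rw [logLik, if_neg h, logLikReal]

/-- Finiteness of `f` is the closed condition that `Q` is nonpositive wherever `W` vanishes. On this
set `f` is the linear function `logLikReal`, for which the value `log 0 = 0` is harmless. -/
lemma isClosed_logLik_ne_bot (W : X → Y → ℝ) : IsClosed {Q | logLik W Q ≠ ⊥} := by
  simp only [logLik_ne_bot_iff, Set.ofPred_forall]
  exact isClosed_iInter fun x => isClosed_iInter fun y => isClosed_iInter fun _ =>
    isClosed_le (continuous_apply _) continuous_const

lemma sum_mul_log_margX (Q : X × Y → ℝ) :
    ∑ x, ∑ y, Q (x, y) * Real.log (margX Q x) = -entropy (margX Q) := by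
  rw [entropy, ← Finset.sum_neg_distrib]
  refine Finset.sum_congr rfl fun x _ => ?_
  rw [← Finset.sum_mul, Real.negMulLog]
  simp [margX]

lemma sum_mul_log_margY (Q : X × Y → ℝ) :
    ∑ x, ∑ y, Q (x, y) * Real.log (margY Q y) = -entropy (margY Q) := by
  rw [entropy, ← Finset.sum_neg_distrib, Finset.sum_comm]
  refine Finset.sum_congr rfl fun x _ => ?_
  rw [← Finset.sum_mul, Real.negMulLog]
  simp [margY]

lemma sum_mul_log_self (Q : X × Y → ℝ) :
    ∑ x, ∑ y, Q (x, y) * Real.log (Q (x, y)) = -entropy Q := by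
  rw [entropy, ← Finset.sum_neg_distrib, Fintype.sum_prod_type]
  simp [Real.negMulLog]

lemma errorObjective_of_eq_bot {W : X → Y → ℝ} {P : X → ℝ} {Q : X × Y → ℝ}
    (hQ : Q ∈ jointWith Y P) (h : logLik W Q = ⊥) : errorObjective W P Q = ⊤ := by
  obtain ⟨x, y, hq, hw⟩ := logLik_eq_bot_iff.1 h
  have hP : 0 < margX Q x := hq.trans_le (le_margX hQ.1.1 x y)
  rw [errorObjective, condDiv, if_pos ⟨x, y, hQ.2 ▸ hP, div_pos hq hP, hw⟩]

/-- Expanding the logarithms termwise gives `D = H(P) - H(Q) - f(Q)`. This form is continuous in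
`Q`, also where entries vanish. -/
lemma errorObjective_of_ne_bot {W : X → Y → ℝ} {P : X → ℝ} {Q : X × Y → ℝ}
    (hQ : Q ∈ jointWith Y P) (h : logLik W Q ≠ ⊥) :
    errorObjective W P Q = (condDivReal W P Q : ℝ) := by
  have h' := logLik_ne_bot_iff.1 h
  obtain ⟨⟨h0, -⟩, rfl⟩ := hQ
  rw [errorObjective, condDiv, if_neg]
  · congr 1
    rw [condDivReal]
    have e1 := sum_mul_log_margX Q
    have e2 := sum_mul_log_self Q
    rw [← neg_eq_iff_eq_neg] at e1 e2
    rw [← e1, ← e2, logLikReal, ← Finset.sum_neg_distrib, ← Finset.sum_neg_distrib,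
      ← Finset.sum_sub_distrib, ← Finset.sum_sub_distrib]
    refine Finset.sum_congr rfl fun x _ => ?_
    rw [Finset.mul_sum, ← Finset.sum_neg_distrib, ← Finset.sum_neg_distrib,
      ← Finset.sum_sub_distrib, ← Finset.sum_sub_distrib]
    refine Finset.sum_congr rfl fun y _ => ?_
    rcases (h0 (x, y)).eq_or_lt with hq | hq
    · simp [condYX, ← hq]
    · have hP : 0 < margX Q x := hq.trans_le (le_margX h0 x y)
      have hw : W x y ≠ 0 := fun hw => absurd (h' x y hw) (not_le.2 hq)
      rw [condYX, Real.log_div (div_pos hq hP).ne' hw, Real.log_div hq.ne' hP.ne']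
      field_simp
      ring
  · rintro ⟨x, y, hP, hq, hw⟩
    have : Q (x, y) = 0 := le_antisymm (h' x y hw) (h0 _)
    simp [condYX, this] at hq

lemma mutualInfo_eq {P : X → ℝ} {Q : X × Y → ℝ} (hQ : Q ∈ jointWith Y P) :
    mutualInfo Q = entropy P + entropy (margY Q) - entropy Q := by
  obtain ⟨⟨h0, -⟩, rfl⟩ := hQ
  have e1 := sum_mul_log_margX Q
  have e2 := sum_mul_log_self Q
  have e3 := sum_mul_log_margY Q
  rw [← neg_eq_iff_eq_neg] at e1 e2 e3
  rw [← e1, ← e2, ← e3, mutualInfo]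
  simp only [← Finset.sum_neg_distrib, ← Finset.sum_add_distrib, ← Finset.sum_sub_distrib]
  refine Finset.sum_congr rfl fun x _ => Finset.sum_congr rfl fun y _ => ?_
  rcases (h0 (x, y)).eq_or_lt with hq | hq
  · simp [← hq]
  · have hX : 0 < margX Q x := hq.trans_le (le_margX h0 x y)
    have hY : 0 < margY Q y := hq.trans_le (le_margY h0 x y)
    rw [Real.log_div hq.ne' (mul_pos hX hY).ne', Real.log_mul hX.ne' hY.ne']
    ring

lemma empirical_mem_stdSimplex [Fintype A] (hn : 0 < n) (x : Fin n → A) :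
    empirical x ∈ stdSimplex ℝ A := by
  refine ⟨fun a => by rw [empirical_apply]; positivity, ?_⟩
  simp only [empirical_apply]
  rw [← Finset.sum_div, ← Nat.cast_sum, sum_letterCount, div_self]
  positivity

lemma jointEmpirical_mem_jointWith (hn : 0 < n) {P : X → ℝ} {x : Fin n → X}
    (hx : x ∈ typeClass n P) (y : Fin n → Y) : jointEmpirical x y ∈ jointWith Y P :=
  ⟨empirical_mem_stdSimplex hn _, (margX_jointEmpirical x y).trans (mem_typeClass.1 hx)⟩

/-! ### The channel law in terms of joint types -/

lemma letterCount_pos_iff {x : Fin n → A} {a : A} : 0 < letterCount x a ↔ ∃ i, x i = a := by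
  rw [letterCount, Finset.card_pos]
  exact ⟨fun ⟨i, hi⟩ => ⟨i, (Finset.mem_filter.1 hi).2⟩,
    fun ⟨i, hi⟩ => ⟨i, Finset.mem_filter.2 ⟨Finset.mem_univ i, hi⟩⟩⟩

lemma sum_comp_letterCount [Fintype A] (z : Fin n → A) (h : A → ℝ) :
    ∑ i, h (z i) = ∑ a, (letterCount z a : ℝ) * h a := by
  rw [← Finset.sum_fiberwise Finset.univ z]
  refine Finset.sum_congr rfl fun a _ => ?_
  rw [Finset.sum_congr rfl (g := fun _ => h a) fun i hi => by rw [(Finset.mem_filter.1 hi).2],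
    Finset.sum_const, nsmul_eq_mul, letterCount]

lemma channelProb_of_eq_bot {W : X → Y → ℝ} {x : Fin n → X} {y : Fin n → Y}
    (h : logLik W (jointEmpirical x y) = ⊥) : channelProb W x y = 0 := by
  obtain ⟨a, b, hq, hw⟩ := logLik_eq_bot_iff.1 h
  have : letterCount (fun i => (x i, y i)) (a, b) ≠ 0 := fun h0 => by
    rw [jointEmpirical, empirical_apply, h0] at hq
    simp at hq
  obtain ⟨i, hi'⟩ := letterCount_pos_iff.1 (Nat.pos_of_ne_zero this)
  simp only [Prod.mk.injEq] at hi'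
  exact Finset.prod_eq_zero (Finset.mem_univ i) (by rw [hi'.1, hi'.2, hw])

lemma channelProb_of_ne_bot {W : X → Y → ℝ} (hW : ∀ x y, 0 ≤ W x y) {x : Fin n → X}
    {y : Fin n → Y} (h : logLik W (jointEmpirical x y) ≠ ⊥) :
    channelProb W x y = Real.exp (n * logLikReal W (jointEmpirical x y)) := by
  have h' := logLik_ne_bot_iff.1 h
  have hpos : ∀ i, 0 < W (x i) (y i) := fun i => by
    refine lt_of_le_of_ne (hW _ _) fun hw => ?_
    have h1 := h' _ _ hw.symm
    have h2 : 0 < letterCount (fun i => (x i, y i)) (x i, y i) :=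
      letterCount_pos_iff.2 ⟨i, rfl⟩
    have h3 : 0 < n := i.pos
    rw [jointEmpirical, empirical_apply] at h1
    have : (0 : ℝ) < (letterCount (fun i => (x i, y i)) (x i, y i) : ℝ) / n := by positivity
    linarith
  have h1 := sum_comp_letterCount (fun i => (x i, y i)) (fun z => Real.log (W z.1 z.2))
  rw [Fintype.sum_prod_type] at h1
  rw [logLikReal, Finset.mul_sum]
  simp only [Finset.mul_sum, ← mul_assoc, jointEmpirical, ← letterCount_eq]
  rw [← h1, Real.exp_sum, channelProb]
  exact Finset.prod_congr rfl fun i _ => (Real.exp_log (hpos i)).symm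

end SingleLetter

/-- The event that the codeword `x` is on the list when `y` is received. -/
def Accepts [Fintype X] [Fintype Y] (W : X → Y → ℝ) (g : OutputThreshold Y) (x : Fin n → X)
    (y : Fin n → Y) : Prop :=
  g.eval (empirical y) ≤ logLik W (jointEmpirical x y)

/-! ### Ensemble averages -/

section Ensemble

variable [Fintype X] [Fintype Y]

lemma card_typeClass_cast_pos {P : X → ℝ} (hT : (typeClass n P).Nonempty) :
    (0 : ℝ) < (typeClass n P).card := by
  exact_mod_cast hT.card_pos

lemma ensembleAvg_sum {P : X → ℝ} {M : ℕ} {ι : Type*} (s : Finset ι)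
    (F : ι → (Fin M → Fin n → X) → ℝ) :
    ensembleAvg P n M (fun C => ∑ i ∈ s, F i C) = ∑ i ∈ s, ensembleAvg P n M (F i) := by
  simp only [ensembleAvg]
  rw [Finset.sum_comm, Finset.sum_div]

lemma ensembleAvg_const_mul {P : X → ℝ} {M : ℕ} (c : ℝ) (F : (Fin M → Fin n → X) → ℝ) :
    ensembleAvg P n M (fun C => c * F C) = c * ensembleAvg P n M F := by
  simp only [ensembleAvg]
  rw [← Finset.mul_sum, mul_div_assoc]

/-- Independence of the codewords, as distributivity of a product over sums. Averages depending on
one or two codewords follow by taking the other factors to be `1`. -/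
lemma ensembleAvg_prod {P : X → ℝ} {M : ℕ} (f : Fin M → (Fin n → X) → ℝ) :
    ensembleAvg P n M (fun C => ∏ m, f m (C m)) =
      ∏ m, ((∑ x ∈ typeClass n P, f m x) / (typeClass n P).card) := by
  rw [ensembleAvg, Finset.prod_div_distrib, Finset.prod_univ_sum]
  simp

lemma ensembleAvg_apply {P : X → ℝ} (hT : (typeClass n P).Nonempty) {M : ℕ} (m : Fin M)
    (h : (Fin n → X) → ℝ) :
    ensembleAvg P n M (fun C => h (C m)) = (∑ x ∈ typeClass n P, h x) / (typeClass n P).card := by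
  have hpos := card_typeClass_cast_pos hT
  have := ensembleAvg_prod (P := P) (n := n) (M := M) (fun k x => if k = m then h x else 1)
  simp only [Finset.prod_ite_eq', Finset.mem_univ, if_true] at this
  rw [this, Finset.prod_eq_single m]
  · simp
  · intro k _ hk
    simp [hk, div_self hpos.ne']
  · simp

lemma ensembleAvg_apply_mul_apply {P : X → ℝ} (hT : (typeClass n P).Nonempty) {M : ℕ}
    {m l : Fin M} (hml : l ≠ m) (h k : (Fin n → X) → ℝ) :
    ensembleAvg P n M (fun C => h (C m) * k (C l)) =
      ((∑ x ∈ typeClass n P, h x) / (typeClass n P).card) *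
        ((∑ x ∈ typeClass n P, k x) / (typeClass n P).card) := by
  have hpos := card_typeClass_cast_pos hT
  have := ensembleAvg_prod (P := P) (n := n) (M := M)
    (fun j x => (if j = m then h x else 1) * (if j = l then k x else 1))
  simp only [Finset.prod_mul_distrib, Finset.prod_ite_eq', Finset.mem_univ, if_true] at this
  rw [this, Finset.prod_eq_mul m l hml.symm]
  · simp [hml, hml.symm]
  · intro j _ hj
    simp [hj.1, hj.2, div_self hpos.ne']
  · simp
  · simp

/-- Whether `x_m` is listed depends on no other codeword, and all codewords have the same law. The
average over messages therefore cancels `M`, which is why `R` disappears. -/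
lemma ensembleAvg_errorProb (W : X → Y → ℝ) {P : X → ℝ} (g : OutputThreshold Y)
    (hT : (typeClass n P).Nonempty) {M : ℕ} (hM : 0 < M) :
    ensembleAvg P n M (fun C => errorProb W C (thresholdDecoder W g n M C)) =
      (∑ x ∈ typeClass n P, ∑ y,
        if Accepts W g x y then 0 else channelProb W x y) /
        (typeClass n P).card := by
  unfold errorProb
  rw [ensembleAvg_const_mul, ensembleAvg_sum]
  have hM' : (M : ℝ) ≠ 0 := by positivity
  have h : ∀ m : Fin M, ensembleAvg P n M (fun C => ∑ y,
      if y ∈ thresholdDecoder W g n M C m then 0 else channelProb W (C m) y) =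
        (∑ x ∈ typeClass n P, ∑ y, if Accepts W g x y then 0 else channelProb W x y) /
          (typeClass n P).card := fun m => ensembleAvg_apply hT m fun x => ∑ y,
    if Accepts W g x y then 0 else channelProb W x y
  rw [Finset.sum_congr rfl fun m _ => h m]
  rw [Finset.sum_const, Finset.card_univ, Fintype.card_fin, nsmul_eq_mul]
  field_simp

/-- The sent codeword and a competitor are independent, so for fixed `y` the average factorizes;
there are `M - 1` competitors. -/
lemma ensembleAvg_listSize (W : X → Y → ℝ) {P : X → ℝ} (g : OutputThreshold Y)
    (hT : (typeClass n P).Nonempty) {M : ℕ} (hM : 0 < M) :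
    ensembleAvg P n M (fun C => listSize W C (thresholdDecoder W g n M C)) =
      ((M : ℝ) - 1) * ∑ y, (((∑ x ∈ typeClass n P, channelProb W x y) / (typeClass n P).card) *
        ((∑ x ∈ typeClass n P,
          if Accepts W g x y then 1 else 0) /
          (typeClass n P).card)) := by
  unfold listSize
  have hM' : (M : ℝ) ≠ 0 := by positivity
  rw [ensembleAvg_sum, Finset.mul_sum]
  refine Finset.sum_congr rfl fun y _ => ?_
  rw [ensembleAvg_const_mul, ensembleAvg_sum]
  set B := ((∑ x ∈ typeClass n P, channelProb W x y) / (typeClass n P).card) *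
        ((∑ x ∈ typeClass n P,
          if Accepts W g x y then (1 : ℝ) else 0) /
          (typeClass n P).card) with hB
  have h : ∀ m : Fin M, ∑ l ∈ Finset.univ.filter (fun l => l ≠ m),
      ensembleAvg P n M (fun C => channelProb W (C m) y *
        if y ∈ thresholdDecoder W g n M C l then 1 else 0) = ((M : ℝ) - 1) * B := by
    intro m
    rw [Finset.sum_congr rfl (g := fun _ => B)]
    · rw [Finset.sum_const, nsmul_eq_mul, Finset.filter_ne', Finset.card_erase_of_mem
        (Finset.mem_univ m), Finset.card_univ, Fintype.card_fin, Nat.cast_pred hM]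
    · intro l hl
      exact ensembleAvg_apply_mul_apply hT (Finset.mem_filter.1 hl).2
        (fun x => channelProb W x y)
        (fun x => if Accepts W g x y then 1 else 0)
  have h' : ∀ m : Fin M, ensembleAvg P n M (fun C => channelProb W (C m) y *
      ∑ l ∈ Finset.univ.filter (fun l => l ≠ m),
        if y ∈ thresholdDecoder W g n M C l then 1 else 0) = ((M : ℝ) - 1) * B := fun m => by
    simp only [Finset.mul_sum]
    rw [ensembleAvg_sum, h m]
  rw [Finset.sum_congr rfl fun m _ => h' m, Finset.sum_const, Finset.card_univ, Fintype.card_fin,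
    nsmul_eq_mul]
  field_simp

end Ensemble

/-! ### Bounds on the ensemble averages at a fixed block length -/

section Bounds

variable [Fintype X] [Fintype Y]

/-- The left side is the probability that a uniform input of type `P` and its output have the joint
type of `(x, y)`: every pair in that class has the same probability. -/
lemma card_mul_channelProb_le {W : X → Y → ℝ} (hW : ∀ x y, 0 ≤ W x y) {P : X → ℝ} (hn : 0 < n)
    {x : Fin n → X} (hx : x ∈ typeClass n P) {y : Fin n → Y}
    (h : logLik W (jointEmpirical x y) ≠ ⊥) :
    (typeClass n (jointEmpirical x y)).card * channelProb W x y / (typeClass n P).card ≤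
      ((n : ℝ) + 1) ^ Fintype.card X * Real.exp (-(n * condDivReal W P (jointEmpirical x y))) := by
  have hP := mem_typeClass.1 hx
  have hpos : (0 : ℝ) < (typeClass n P).card := card_typeClass_cast_pos ⟨x, hx⟩
  have h1 := card_typeClass_le hn (fun i => (x i, y i))
  have h2 := le_card_typeClass hn x
  rw [hP] at h2
  rw [div_le_iff₀ hpos, channelProb_of_ne_bot hW h]
  have e : Real.exp (-(n * condDivReal W P (jointEmpirical x y))) =
      Real.exp (n * entropy (jointEmpirical x y)) * Real.exp (n * logLikReal W (jointEmpirical x y))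
        / Real.exp (n * entropy P) := by
    rw [← Real.exp_add, ← Real.exp_sub]
    congr 1
    rw [condDivReal]
    ring
  rw [e]
  calc _ ≤ Real.exp (n * entropy (jointEmpirical x y)) *
        Real.exp (n * logLikReal W (jointEmpirical x y)) :=
        mul_le_mul_of_nonneg_right h1 (Real.exp_nonneg _)
    _ = (Real.exp (n * entropy (jointEmpirical x y)) *
        Real.exp (n * logLikReal W (jointEmpirical x y)) / Real.exp (n * entropy P)) *
        Real.exp (n * entropy P) := by
        rw [div_mul_cancel₀ _ (Real.exp_ne_zero _)]
    _ ≤ _ := mul_le_mul_of_nonneg_left h2 (by positivity)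
    _ = _ := by ring

lemma le_card_mul_channelProb {W : X → Y → ℝ} (hW : ∀ x y, 0 ≤ W x y) {P : X → ℝ} (hn : 0 < n)
    {x : Fin n → X} (hx : x ∈ typeClass n P) {y : Fin n → Y}
    (h : logLik W (jointEmpirical x y) ≠ ⊥) :
    Real.exp (-(n * condDivReal W P (jointEmpirical x y))) ≤
      ((n : ℝ) + 1) ^ Fintype.card (X × Y) *
        ((typeClass n (jointEmpirical x y)).card * channelProb W x y / (typeClass n P).card) := by
  have hP := mem_typeClass.1 hx
  have hpos : (0 : ℝ) < (typeClass n P).card := card_typeClass_cast_pos ⟨x, hx⟩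
  have h1 := le_card_typeClass hn (fun i => (x i, y i))
  have h2 := card_typeClass_le hn x
  rw [hP] at h2
  rw [← mul_div_assoc, le_div_iff₀ hpos, channelProb_of_ne_bot hW h]
  have e : Real.exp (-(n * condDivReal W P (jointEmpirical x y))) =
      Real.exp (n * entropy (jointEmpirical x y)) * Real.exp (n * logLikReal W (jointEmpirical x y))
        / Real.exp (n * entropy P) := by
    rw [← Real.exp_add, ← Real.exp_sub]
    congr 1
    rw [condDivReal]
    ring
  rw [e]
  calc _ ≤ (Real.exp (n * entropy (jointEmpirical x y)) *
        Real.exp (n * logLikReal W (jointEmpirical x y)) / Real.exp (n * entropy P)) *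
        Real.exp (n * entropy P) := mul_le_mul_of_nonneg_left h2 (by positivity)
    _ = Real.exp (n * entropy (jointEmpirical x y)) *
        Real.exp (n * logLikReal W (jointEmpirical x y)) := by
        rw [div_mul_cancel₀ _ (Real.exp_ne_zero _)]
    _ ≤ _ := mul_le_mul_of_nonneg_right h1 (Real.exp_nonneg _)
    _ = _ := by
      rw [mul_assoc]
      rfl

/-- By `condCount_jointEmpirical`, the left side is the probability that an independent uniform
codeword has this joint type with the given `y`. -/
lemma card_div_le_exp_mutualInfo {P : X → ℝ} (hn : 0 < n)
    {x : Fin n → X} (hx : x ∈ typeClass n P) (y : Fin n → Y) :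
    ((typeClass n (jointEmpirical x y)).card : ℝ) /
        ((typeClass n (empirical y)).card * (typeClass n P).card) ≤
      ((n : ℝ) + 1) ^ (Fintype.card X + Fintype.card Y) *
        Real.exp (-(n * mutualInfo (jointEmpirical x y))) := by
  have hP := mem_typeClass.1 hx
  have hpos : (0 : ℝ) < (typeClass n P).card := card_typeClass_cast_pos ⟨x, hx⟩
  have hpos' := card_typeClass_pos y
  have h1 := card_typeClass_le hn (fun i => (x i, y i))
  have h2 := le_card_typeClass hn x
  have h3 := le_card_typeClass hn y
  rw [hP] at h2
  rw [div_le_iff₀ (by positivity), mutualInfo_eq (jointEmpirical_mem_jointWith hn hx y),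
    margY_jointEmpirical]
  have e : Real.exp (-(n * (entropy P + entropy (empirical y) - entropy (jointEmpirical x y)))) =
      Real.exp (n * entropy (jointEmpirical x y)) /
        (Real.exp (n * entropy (empirical y)) * Real.exp (n * entropy P)) := by
    rw [← Real.exp_add, ← Real.exp_sub]
    congr 1
    ring
  rw [e]
  have h4 := mul_le_mul h3 h2 (Real.exp_nonneg _) (by positivity)
  calc _ ≤ Real.exp (n * entropy (jointEmpirical x y)) := h1
    _ = (Real.exp (n * entropy (jointEmpirical x y)) /
        (Real.exp (n * entropy (empirical y)) * Real.exp (n * entropy P))) *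
        (Real.exp (n * entropy (empirical y)) * Real.exp (n * entropy P)) := by
        rw [div_mul_cancel₀ _ (by positivity)]
    _ ≤ _ := mul_le_mul_of_nonneg_left h4 (by positivity)
    _ = _ := by ring

lemma exp_mutualInfo_le_card_div {P : X → ℝ} (hn : 0 < n)
    {x : Fin n → X} (hx : x ∈ typeClass n P) (y : Fin n → Y) :
    Real.exp (-(n * mutualInfo (jointEmpirical x y))) ≤
      ((n : ℝ) + 1) ^ Fintype.card (X × Y) * (((typeClass n (jointEmpirical x y)).card : ℝ) /
        ((typeClass n (empirical y)).card * (typeClass n P).card)) := by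
  have hP := mem_typeClass.1 hx
  have hpos : (0 : ℝ) < (typeClass n P).card := card_typeClass_cast_pos ⟨x, hx⟩
  have hpos' := card_typeClass_pos y
  have h1 := le_card_typeClass hn (fun i => (x i, y i))
  have h2 := card_typeClass_le hn x
  have h3 := card_typeClass_le hn y
  rw [hP] at h2
  rw [← mul_div_assoc, le_div_iff₀ (by positivity),
    mutualInfo_eq (jointEmpirical_mem_jointWith hn hx y), margY_jointEmpirical]
  have e : Real.exp (-(n * (entropy P + entropy (empirical y) - entropy (jointEmpirical x y)))) =
      Real.exp (n * entropy (jointEmpirical x y)) /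
        (Real.exp (n * entropy (empirical y)) * Real.exp (n * entropy P)) := by
    rw [← Real.exp_add, ← Real.exp_sub]
    congr 1
    ring
  rw [e]
  have h4 := mul_le_mul h3 h2 hpos.le (Real.exp_nonneg _)
  calc _ ≤ (Real.exp (n * entropy (jointEmpirical x y)) /
        (Real.exp (n * entropy (empirical y)) * Real.exp (n * entropy P))) *
        (Real.exp (n * entropy (empirical y)) * Real.exp (n * entropy P)) :=
        mul_le_mul_of_nonneg_left h4 (by positivity)
    _ = Real.exp (n * entropy (jointEmpirical x y)) := by
        rw [div_mul_cancel₀ _ (by positivity)]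
    _ ≤ _ := h1

lemma sum_sum_inv_card_le :
    ∑ y : Fin n → Y, ∑ x : Fin n → X, 1 / ((typeClass n (jointEmpirical x y)).card : ℝ) ≤
      ((n : ℝ) + 1) ^ (Fintype.card Y + Fintype.card (X × Y)) := by
  calc _ = ∑ y : Fin n → Y, 1 / ((typeClass n (empirical y)).card : ℝ) *
        ∑ x : Fin n → X, ((typeClass n (empirical y)).card : ℝ) /
          (typeClass n (jointEmpirical x y)).card := by
        refine Finset.sum_congr rfl fun y _ => ?_
        rw [Finset.mul_sum]
        refine Finset.sum_congr rfl fun x _ => ?_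
        have := card_typeClass_pos y
        field_simp
    _ ≤ ∑ y : Fin n → Y, 1 / ((typeClass n (empirical y)).card : ℝ) *
        ((n : ℝ) + 1) ^ Fintype.card (X × Y) :=
        Finset.sum_le_sum fun y _ => mul_le_mul_of_nonneg_left (sum_card_ratio_le y) (by positivity)
    _ ≤ _ := by
        rw [← Finset.sum_mul, pow_add]
        exact mul_le_mul_of_nonneg_right sum_inv_card_typeClass_le (by positivity)

lemma jointEmpirical_mem_errorSetStrict {W : X → Y → ℝ} {P : X → ℝ} {g : OutputThreshold Y}
    (hn : 0 < n) {x : Fin n → X} (hx : x ∈ typeClass n P) {y : Fin n → Y}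
    (h : ¬ Accepts W g x y) : jointEmpirical x y ∈ errorSetStrict W P g := by
  refine ⟨jointEmpirical_mem_jointWith hn hx y, ?_⟩
  rw [margY_jointEmpirical]
  exact not_le.1 h

/-- Every term is at most `K` over the size of its joint type class, and these inverse sizes have a
polynomial sum. -/
lemma ensembleAvg_errorProb_le {W : X → Y → ℝ} (hW : ∀ x y, 0 ≤ W x y) {P : X → ℝ}
    {g : OutputThreshold Y} (hn : 0 < n) (hT : (typeClass n P).Nonempty) {M : ℕ} (hM : 0 < M)
    {c : ℝ} (hc : ∀ Q ∈ errorSetStrict W P g, (c : EReal) ≤ errorObjective W P Q) :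
    ensembleAvg P n M (fun C => errorProb W C (thresholdDecoder W g n M C)) ≤
      ((n : ℝ) + 1) ^ (Fintype.card X + (Fintype.card Y + Fintype.card (X × Y))) *
        Real.exp (-(n * c)) := by
  have hpos := card_typeClass_cast_pos hT
  rw [ensembleAvg_errorProb W g hT hM, Finset.sum_div]
  set K := ((n : ℝ) + 1) ^ Fintype.card X * Real.exp (-(n * c)) with hK
  have hK0 : 0 ≤ K := by positivity
  have key : ∀ x ∈ typeClass n P, ∀ y : Fin n → Y,
      (if Accepts W g x y then 0 else channelProb W x y) / ((typeClass n P).card : ℝ) ≤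
        K * (1 / (typeClass n (jointEmpirical x y)).card) := by
    intro x hx y
    have hz : (0 : ℝ) < (typeClass n (jointEmpirical x y)).card := card_typeClass_pos _
    split_ifs with hacc
    · rw [zero_div]; positivity
    by_cases hb : logLik W (jointEmpirical x y) = ⊥
    · rw [channelProb_of_eq_bot hb, zero_div]; positivity
    have hmem := jointEmpirical_mem_errorSetStrict hn hx hacc
    have h1 := hc _ hmem
    rw [errorObjective_of_ne_bot hmem.1 hb, EReal.coe_le_coe_iff] at h1
    have h2 := card_mul_channelProb_le hW hn hx hb
    rw [mul_one_div, le_div_iff₀ hz]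
    calc _ = (typeClass n (jointEmpirical x y)).card * channelProb W x y /
          (typeClass n P).card := by ring
      _ ≤ _ := h2
      _ ≤ _ := by
        rw [hK]
        gcongr
  calc _ ≤ ∑ x ∈ typeClass n P, ∑ y : Fin n → Y,
        K * (1 / ((typeClass n (jointEmpirical x y)).card : ℝ)) := by
        refine Finset.sum_le_sum fun x hx => ?_
        rw [Finset.sum_div]
        exact Finset.sum_le_sum fun y _ => key x hx y
    _ ≤ ∑ x : Fin n → X, ∑ y : Fin n → Y,
        K * (1 / ((typeClass n (jointEmpirical x y)).card : ℝ)) :=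
        Finset.sum_le_sum_of_subset_of_nonneg (Finset.subset_univ _)
          fun _ _ _ => Finset.sum_nonneg fun _ _ => by positivity
    _ = K * ∑ y : Fin n → Y, ∑ x : Fin n → X,
        1 / ((typeClass n (jointEmpirical x y)).card : ℝ) := by
        rw [Finset.sum_comm]
        simp only [Finset.mul_sum]
    _ ≤ K * ((n : ℝ) + 1) ^ (Fintype.card Y + Fintype.card (X × Y)) :=
        mul_le_mul_of_nonneg_left sum_sum_inv_card_le hK0
    _ = _ := by
        rw [hK, pow_add _ (Fintype.card X)]
        ring

lemma condCount_mul_le_sum {P : X → ℝ} {Q : X × Y → ℝ} (hQ : margX Q = P) (y : Fin n → Y)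
    {G : (Fin n → X) → ℝ} (hG : ∀ x, 0 ≤ G x) {v : ℝ}
    (hv : ∀ x, jointEmpirical x y = Q → G x = v) :
    condCount Q y * v ≤ ∑ x ∈ typeClass n P, G x := by
  calc _ = ∑ x ∈ Finset.univ.filter fun x : Fin n → X => jointEmpirical x y = Q, G x := by
        rw [Finset.sum_congr rfl (g := fun _ => v) fun x hx => hv x (Finset.mem_filter.1 hx).2,
          Finset.sum_const, nsmul_eq_mul, condCount]
    _ ≤ _ := by
        refine Finset.sum_le_sum_of_subset_of_nonneg (fun x hx => ?_) fun _ _ _ => hG _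
        rw [mem_typeClass, ← margX_jointEmpirical x y, (Finset.mem_filter.1 hx).2, hQ]

lemma channelProb_eq_of_jointEmpirical_eq {W : X → Y → ℝ} (hW : ∀ x y, 0 ≤ W x y)
    {x x' : Fin n → X} {y y' : Fin n → Y} (h : jointEmpirical x y = jointEmpirical x' y') :
    channelProb W x y = channelProb W x' y' := by
  by_cases hb : logLik W (jointEmpirical x y) = ⊥
  · rw [channelProb_of_eq_bot hb, channelProb_of_eq_bot (h ▸ hb)]
  · rw [channelProb_of_ne_bot hW hb, channelProb_of_ne_bot hW (h ▸ hb), h]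

lemma accepts_iff_of_jointEmpirical_eq {W : X → Y → ℝ} {g : OutputThreshold Y}
    {x x' : Fin n → X} {y y' : Fin n → Y} (h : jointEmpirical x y = jointEmpirical x' y') :
    Accepts W g x y ↔ Accepts W g x' y' := by
  unfold Accepts
  rw [← margY_jointEmpirical x y, ← margY_jointEmpirical x' y', h]

/-- Only the pairs with the joint type of `(x, y)` are kept: they are all rejected and have equal
channel probability. -/
lemma le_ensembleAvg_errorProb {W : X → Y → ℝ} (hW : ∀ x y, 0 ≤ W x y) {P : X → ℝ}
    {g : OutputThreshold Y} (hn : 0 < n) {M : ℕ} (hM : 0 < M)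
    {x : Fin n → X} (hx : x ∈ typeClass n P) {y : Fin n → Y} (hacc : ¬ Accepts W g x y)
    (hb : logLik W (jointEmpirical x y) ≠ ⊥) :
    Real.exp (-(n * condDivReal W P (jointEmpirical x y))) ≤
      ((n : ℝ) + 1) ^ Fintype.card (X × Y) *
        ensembleAvg P n M (fun C => errorProb W C (thresholdDecoder W g n M C)) := by
  have hT : (typeClass n P).Nonempty := ⟨x, hx⟩
  have hpos := card_typeClass_cast_pos hT
  rw [ensembleAvg_errorProb W g hT hM]
  refine (le_card_mul_channelProb hW hn hx hb).trans ?_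
  gcongr
  have hnn : ∀ x' : Fin n → X, ∀ y' : Fin n → Y,
      0 ≤ if Accepts W g x' y' then 0 else channelProb W x' y' := fun x' y' => by
    split_ifs
    exacts [le_rfl, channelProb_nonneg hW _ _]
  rw [Finset.sum_comm]
  calc _ = ∑ y' ∈ typeClass n (empirical y),
        (condCount (jointEmpirical x y) y' : ℝ) * channelProb W x y := by
        rw [Finset.sum_congr rfl (g := fun _ =>
          (condCount (jointEmpirical x y) y : ℝ) * channelProb W x y) fun y' hy' => by
            rw [condCount_congr _ (mem_typeClass.1 hy')], Finset.sum_const, nsmul_eq_mul,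
            ← condCount_jointEmpirical]
        ring
    _ ≤ ∑ y' ∈ typeClass n (empirical y), ∑ x' ∈ typeClass n P,
        if Accepts W g x' y' then 0 else channelProb W x' y' := by
        refine Finset.sum_le_sum fun y' _ => condCount_mul_le_sum
          ((margX_jointEmpirical x y).trans (mem_typeClass.1 hx)) y' (fun x' => hnn x' y')
          fun x' hx' => ?_
        rw [if_neg (by rwa [accepts_iff_of_jointEmpirical_eq hx']),
          channelProb_eq_of_jointEmpirical_eq hW hx']
    _ ≤ _ := Finset.sum_le_sum_of_subset_of_nonneg (Finset.subset_univ _)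
        fun y' _ _ => Finset.sum_nonneg fun x' _ => hnn x' y'

lemma jointEmpirical_mem_listFeasible {W : X → Y → ℝ} {P : X → ℝ} {g : OutputThreshold Y}
    (hn : 0 < n) {x : Fin n → X} (hx : x ∈ typeClass n P) {y : Fin n → Y}
    (h : Accepts W g x y) : jointEmpirical x y ∈ listFeasible W P g := by
  refine ⟨jointEmpirical_mem_jointWith hn hx y, ?_⟩
  rw [margY_jointEmpirical]
  exact h

/-- For fixed `y` the weights factor, and their sum over both inputs is `1 / |T_y|` times the square
of the sum in `sum_card_ratio_le`. The remaining sum over `y` counts output types. -/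
lemma sum_mul_sum_le {P : X → ℝ} {K : ℝ} (hK0 : 0 ≤ K) {F G : (Fin n → X) → (Fin n → Y) → ℝ}
    (key : ∀ y, ∀ x ∈ typeClass n P, ∀ x' ∈ typeClass n P, F x y * G x' y ≤
      K * ((typeClass n (empirical y)).card / ((typeClass n (jointEmpirical x y)).card *
        (typeClass n (jointEmpirical x' y)).card))) :
    ∑ y, (∑ x ∈ typeClass n P, F x y) * (∑ x ∈ typeClass n P, G x y) ≤
      K * ((n : ℝ) + 1) ^ (Fintype.card Y + 2 * Fintype.card (X × Y)) := by
  calc _ ≤ ∑ y : Fin n → Y, K * ((1 / ((typeClass n (empirical y)).card : ℝ)) *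
        (∑ x : Fin n → X, ((typeClass n (empirical y)).card : ℝ) /
        (typeClass n (jointEmpirical x y)).card) ^ 2) := by
        refine Finset.sum_le_sum fun y _ => ?_
        have hy := card_typeClass_pos y
        rw [Finset.sum_mul_sum, sq, Finset.sum_mul_sum, Finset.mul_sum, Finset.mul_sum]
        calc _ ≤ ∑ x ∈ typeClass n P, ∑ x' ∈ typeClass n P, K *
              ((typeClass n (empirical y)).card / ((typeClass n (jointEmpirical x y)).card *
              (typeClass n (jointEmpirical x' y)).card)) :=
              Finset.sum_le_sum fun x hx => Finset.sum_le_sum fun x' hx' => key y x hx x' hx'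
          _ ≤ ∑ x : Fin n → X, ∑ x' : Fin n → X, K *
              ((typeClass n (empirical y)).card / ((typeClass n (jointEmpirical x y)).card *
              (typeClass n (jointEmpirical x' y)).card)) :=
              (Finset.sum_le_sum fun x _ => Finset.sum_le_sum_of_subset_of_nonneg
                (Finset.subset_univ _) fun _ _ _ => by positivity).trans
                (Finset.sum_le_sum_of_subset_of_nonneg (Finset.subset_univ _)
                fun _ _ _ => Finset.sum_nonneg fun _ _ => by positivity)
          _ = _ := by
              refine Finset.sum_congr rfl fun x _ => ?_
              rw [Finset.mul_sum, Finset.mul_sum]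
              refine Finset.sum_congr rfl fun x' _ => ?_
              have hz := card_typeClass_pos fun i => (x i, y i)
              have hz' := card_typeClass_pos fun i => (x' i, y i)
              unfold jointEmpirical
              field_simp
    _ ≤ ∑ y : Fin n → Y, K * ((1 / ((typeClass n (empirical y)).card : ℝ)) *
        (((n : ℝ) + 1) ^ Fintype.card (X × Y)) ^ 2) := by
        refine Finset.sum_le_sum fun y _ => ?_
        gcongr
        exact sum_card_ratio_le y
    _ = K * ((∑ y : Fin n → Y, 1 / ((typeClass n (empirical y)).card : ℝ)) *
        (((n : ℝ) + 1) ^ Fintype.card (X × Y)) ^ 2) := by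
        rw [← Finset.mul_sum, Finset.sum_mul]
    _ ≤ K * (((n : ℝ) + 1) ^ Fintype.card Y * (((n : ℝ) + 1) ^ Fintype.card (X × Y)) ^ 2) := by
        gcongr
        exact sum_inv_card_typeClass_le
    _ = _ := by ring

lemma ensembleAvg_listSize_le {W : X → Y → ℝ} (hW : ∀ x y, 0 ≤ W x y) {P : X → ℝ} {R : ℝ}
    {g : OutputThreshold Y} (hn : 0 < n) (hT : (typeClass n P).Nonempty) {M : ℕ} (hM : 0 < M)
    (hMR : (M : ℝ) ≤ Real.exp (n * R))
    {c : ℝ} (hc : ∀ p ∈ pairsOver P (listFeasible W P g), (c : EReal) ≤ listObjective W P R p) :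
    ensembleAvg P n M (fun C => listSize W C (thresholdDecoder W g n M C)) ≤
      ((n : ℝ) + 1) ^ (2 * (Fintype.card X + Fintype.card Y + Fintype.card (X × Y))) *
        Real.exp (-(n * c)) := by
  have hpos := card_typeClass_cast_pos hT
  rw [ensembleAvg_listSize W g hT hM]
  set T : ℝ := ((typeClass n P).card : ℝ)
  -- The exponent is `c + R` because the factor `M - 1 ≤ exp(n R)` is restored only at the end.
  set K := ((n : ℝ) + 1) ^ (2 * Fintype.card X + Fintype.card Y) * Real.exp (-(n * (c + R))) with hK
  have hK0 : 0 ≤ K := by positivity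
  have key : ∀ (y : Fin n → Y), ∀ x ∈ typeClass n P, ∀ x' ∈ typeClass n P,
      channelProb W x y / T * ((if Accepts W g x' y then 1 else 0) / T) ≤
        K * ((typeClass n (empirical y)).card / ((typeClass n (jointEmpirical x y)).card *
          (typeClass n (jointEmpirical x' y)).card)) := by
    intro y x hx x' hx'
    have hz : (0 : ℝ) < (typeClass n (jointEmpirical x y)).card := card_typeClass_pos _
    have hz' : (0 : ℝ) < (typeClass n (jointEmpirical x' y)).card := card_typeClass_pos _
    have hy := card_typeClass_pos y
    split_ifs with hacc
    swap
    · rw [zero_div, mul_zero]; positivity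
    by_cases hb : logLik W (jointEmpirical x y) = ⊥
    · rw [channelProb_of_eq_bot hb, zero_div, zero_mul]; positivity
    have hQ1 := jointEmpirical_mem_jointWith hn hx y
    have hQ2 := jointEmpirical_mem_listFeasible hn hx' hacc
    have h1 := hc (jointEmpirical x y, jointEmpirical x' y)
      ⟨hQ1, hQ2, by rw [margY_jointEmpirical, margY_jointEmpirical]⟩
    have h1' : c + R ≤ condDivReal W P (jointEmpirical x y) + mutualInfo (jointEmpirical x' y) := by
      have e : listObjective W P R (jointEmpirical x y, jointEmpirical x' y) =
        errorObjective W P (jointEmpirical x y) +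
          ((mutualInfo (jointEmpirical x' y) - R : ℝ) : EReal) := rfl
      rw [e, errorObjective_of_ne_bot hQ1 hb, ← EReal.coe_add, EReal.coe_le_coe_iff] at h1
      linarith
    have h2 := card_mul_channelProb_le hW hn hx hb
    have h3 := card_div_le_exp_mutualInfo hn hx' y
    have h4 := mul_le_mul h2 h3 (by positivity) (by positivity)
    have h5 : (((n : ℝ) + 1) ^ Fintype.card X *
        Real.exp (-(n * condDivReal W P (jointEmpirical x y)))) *
        (((n : ℝ) + 1) ^ (Fintype.card X + Fintype.card Y) *
          Real.exp (-(n * mutualInfo (jointEmpirical x' y)))) ≤ K := by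
      calc _ = ((n : ℝ) + 1) ^ (2 * Fintype.card X + Fintype.card Y) *
            Real.exp (-(n * (condDivReal W P (jointEmpirical x y) +
              mutualInfo (jointEmpirical x' y)))) := by
            rw [mul_add, neg_add, Real.exp_add]
            ring
        _ ≤ _ := by
            rw [hK]
            gcongr
    calc _ = ((typeClass n (jointEmpirical x y)).card * channelProb W x y / T *
          ((typeClass n (jointEmpirical x' y)).card / ((typeClass n (empirical y)).card * T))) *
          ((typeClass n (empirical y)).card / ((typeClass n (jointEmpirical x y)).card *
          (typeClass n (jointEmpirical x' y)).card)) := by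
          field_simp
      _ ≤ _ := mul_le_mul_of_nonneg_right (h4.trans h5) (by positivity)
  have hsum := sum_mul_sum_le hK0 key
  simp only [← Finset.sum_div] at hsum
  have hS0 : 0 ≤ ∑ y : Fin n → Y, ((∑ x ∈ typeClass n P, channelProb W x y) / T *
      ((∑ x ∈ typeClass n P, if Accepts W g x y then 1 else 0) / T)) :=
    Finset.sum_nonneg fun y _ => mul_nonneg
      (div_nonneg (Finset.sum_nonneg fun x _ => channelProb_nonneg hW _ _) hpos.le)
      (div_nonneg (Finset.sum_nonneg fun x _ => by split_ifs <;> norm_num) hpos.le)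
  generalize (∑ y : Fin n → Y, ((∑ x ∈ typeClass n P, channelProb W x y) / T *
      ((∑ x ∈ typeClass n P, if Accepts W g x y then (1 : ℝ) else 0) / T))) = S at hsum hS0 ⊢
  have hM1 : (0 : ℝ) ≤ (M : ℝ) - 1 := by
    have : (1 : ℝ) ≤ M := by exact_mod_cast hM
    linarith
  calc ((M : ℝ) - 1) * S ≤
      Real.exp (n * R) * (K * ((n : ℝ) + 1) ^ (Fintype.card Y + 2 * Fintype.card (X × Y))) :=
        mul_le_mul (by linarith) hsum hS0 (Real.exp_nonneg _)
    _ = _ := by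
        have : Real.exp (-(n * c)) = Real.exp (n * R) * Real.exp (-(n * (c + R))) := by
          rw [← Real.exp_add]
          congr 1
          ring
        rw [hK, this]
        ring

/-- Kept are the outputs of the type of `y`, and for each of them only the inputs with the two
prescribed joint types. -/
lemma le_ensembleAvg_listSize {W : X → Y → ℝ} (hW : ∀ x y, 0 ≤ W x y) {P : X → ℝ}
    {g : OutputThreshold Y} (hn : 0 < n) {M : ℕ} (hM : 0 < M)
    {x x' : Fin n → X} (hx : x ∈ typeClass n P) (hx' : x' ∈ typeClass n P) {y : Fin n → Y}
    (hacc : Accepts W g x' y) (hb : logLik W (jointEmpirical x y) ≠ ⊥) :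
    ((M : ℝ) - 1) * Real.exp (-(n * (condDivReal W P (jointEmpirical x y) +
        mutualInfo (jointEmpirical x' y)))) ≤
      ((n : ℝ) + 1) ^ (2 * Fintype.card (X × Y)) *
        ensembleAvg P n M (fun C => listSize W C (thresholdDecoder W g n M C)) := by
  have hT : (typeClass n P).Nonempty := ⟨x, hx⟩
  have hpos := card_typeClass_cast_pos hT
  have hM1 : (0 : ℝ) ≤ (M : ℝ) - 1 := by
    have : (1 : ℝ) ≤ M := by exact_mod_cast hM
    linarith
  rw [ensembleAvg_listSize W g hT hM]
  set T : ℝ := ((typeClass n P).card : ℝ)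
  have hy := card_typeClass_pos y
  have h1 := le_card_mul_channelProb hW hn hx hb
  have h2 := exp_mutualInfo_le_card_div hn hx' y
  have h3 := mul_le_mul h1 h2 (Real.exp_nonneg _) ((Real.exp_nonneg _).trans h1)
  rw [← Real.exp_add, ← neg_add, ← mul_add] at h3
  have h4 : (typeClass n (jointEmpirical x y)).card * channelProb W x y / T *
      ((typeClass n (jointEmpirical x' y)).card / ((typeClass n (empirical y)).card * T)) ≤
      ∑ y : Fin n → Y, ((∑ x ∈ typeClass n P, channelProb W x y) / T *
        ((∑ x ∈ typeClass n P, if Accepts W g x y then 1 else 0) / T)) := by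
    calc _ = ∑ y' ∈ typeClass n (empirical y),
          ((condCount (jointEmpirical x y) y' * channelProb W x y) / T *
            ((condCount (jointEmpirical x' y) y' * 1) / T)) := by
          rw [Finset.sum_congr rfl (g := fun _ =>
            ((condCount (jointEmpirical x y) y * channelProb W x y) / T *
            ((condCount (jointEmpirical x' y) y * 1) / T))) fun y' hy' => by
              rw [condCount_congr _ (mem_typeClass.1 hy'),
                condCount_congr (jointEmpirical x' y) (mem_typeClass.1 hy')],
              Finset.sum_const, nsmul_eq_mul, ← condCount_jointEmpirical,
              ← condCount_jointEmpirical]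
          field_simp
      _ ≤ ∑ y' ∈ typeClass n (empirical y), ((∑ x ∈ typeClass n P, channelProb W x y') / T *
        ((∑ x ∈ typeClass n P, if Accepts W g x y' then 1 else 0) / T)) := by
          refine Finset.sum_le_sum fun y' _ => ?_
          have a1 : condCount (jointEmpirical x y) y' * channelProb W x y ≤
              ∑ x ∈ typeClass n P, channelProb W x y' :=
            condCount_mul_le_sum ((margX_jointEmpirical x y).trans (mem_typeClass.1 hx)) y'
              (fun _ => channelProb_nonneg hW _ _)
              fun _ h => channelProb_eq_of_jointEmpirical_eq hW h
          have a2 : (condCount (jointEmpirical x' y) y' : ℝ) * 1 ≤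
              ∑ x ∈ typeClass n P, if Accepts W g x y' then 1 else 0 :=
            condCount_mul_le_sum ((margX_jointEmpirical x' y).trans (mem_typeClass.1 hx')) y'
              (fun _ => by split_ifs <;> norm_num)
              fun _ h => if_pos ((accepts_iff_of_jointEmpirical_eq h).2 hacc)
          have a3 := channelProb_nonneg hW x y
          gcongr
          exact div_nonneg (Finset.sum_nonneg fun x _ => channelProb_nonneg hW _ _) hpos.le
      _ ≤ _ := Finset.sum_le_sum_of_subset_of_nonneg (Finset.subset_univ _)
          fun y' _ _ => mul_nonneg
          (div_nonneg (Finset.sum_nonneg fun x _ => channelProb_nonneg hW _ _) hpos.le)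
          (div_nonneg (Finset.sum_nonneg fun x _ => by split_ifs <;> norm_num) hpos.le)
  generalize (∑ y : Fin n → Y, ((∑ x ∈ typeClass n P, channelProb W x y) / T *
      ((∑ x ∈ typeClass n P, if Accepts W g x y then (1 : ℝ) else 0) / T))) = S at h4 ⊢
  refine (mul_le_mul_of_nonneg_left h3 hM1).trans ?_
  calc _ = ((M : ℝ) - 1) * (((n : ℝ) + 1) ^ (2 * Fintype.card (X × Y)) *
        ((typeClass n (jointEmpirical x y)).card * channelProb W x y / T *
      ((typeClass n (jointEmpirical x' y)).card / ((typeClass n (empirical y)).card * T)))) := by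
        ring
    _ ≤ ((M : ℝ) - 1) * (((n : ℝ) + 1) ^ (2 * Fintype.card (X × Y)) * S) := by
        gcongr
    _ = _ := by ring

end Bounds

/-! ### Rational approximation -/

/-- Extend `1` to a `ℚ`-basis of `ℝ`, round the basis elements to rationals and extend linearly. A
fixed real involves finitely many basis elements with fixed rational coefficients, hence the
pointwise convergence. -/
lemma exists_rat_linear_approx : ∃ φ : ℕ → ℝ →ₗ[ℚ] ℚ, (∀ k, φ k 1 = 1) ∧
    ∀ v, Tendsto (fun k => (φ k v : ℝ)) atTop (𝓝 v) := by
  have hli : LinearIndepOn ℚ id ({1} : Set ℝ) :=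
    LinearIndepOn.singleton (by simp)
  let b := Module.Basis.extend hli
  have hb : ∀ i, b i = (i : ℝ) := fun i => Module.Basis.extend_apply_self hli i
  -- Rounding errs by at most `1 / (k + 1)` and leaves `1` exact, so that the linear extension fixes
  -- the rationals.
  have hex : ∀ (k : ℕ) (v : ℝ), ∃ r : ℚ, (v = 1 → r = 1) ∧ v ≤ r ∧ (r : ℝ) ≤ v + 1 / ((k : ℝ) + 1) := by
    intro k v
    have hk : (0 : ℝ) < 1 / ((k : ℝ) + 1) := by positivity
    by_cases hv : v = 1
    · exact ⟨1, fun _ => rfl, by simp [hv], by simp [hv]; positivity⟩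
    · obtain ⟨r, h1, h2⟩ := exists_rat_btwn (show v < v + 1 / ((k : ℝ) + 1) by linarith)
      exact ⟨r, fun h => absurd h hv, h1.le, h2.le⟩
  choose r hr1 hr2 hr3 using hex
  have hr : ∀ v, Tendsto (fun k => (r k v : ℝ)) atTop (𝓝 v) := fun v => by
    refine tendsto_of_tendsto_of_tendsto_of_le_of_le tendsto_const_nhds ?_ (fun k => hr2 k v)
      (fun k => hr3 k v)
    simpa using tendsto_one_div_add_atTop_nhds_zero_nat.const_add v
  refine ⟨fun k => b.constr ℚ fun i => r k i, fun k => ?_, fun v => ?_⟩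
  · have h1 : (1 : ℝ) ∈ hli.extend (Set.subset_univ _) :=
      hli.subset_extend _ (Set.mem_singleton _)
    have := b.constr_basis ℚ (fun i => r k i) ⟨1, h1⟩
    rw [hb] at this
    exact this.trans (hr1 k 1 rfl)
  · have h1 : v = ∑ i ∈ (b.repr v).support, ((b.repr v i : ℚ) : ℝ) * (i : ℝ) := by
      conv_lhs => rw [← b.linearCombination_repr v]
      rw [Finsupp.linearCombination_apply, Finsupp.sum]
      exact Finset.sum_congr rfl fun i _ => by rw [hb, Rat.smul_def]
    have h2 : ∀ k, ((b.constr ℚ (fun i => r k i) v : ℚ) : ℝ) =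
        ∑ i ∈ (b.repr v).support, ((b.repr v i : ℚ) : ℝ) * (r k i : ℝ) := by
      intro k
      rw [Module.Basis.constr_apply, Finsupp.sum, Rat.cast_sum]
      exact Finset.sum_congr rfl fun i _ => by rw [smul_eq_mul, Rat.cast_mul]
    simp only [h2]
    conv => rhs; rw [h1]
    exact tendsto_finsetSum _ fun i _ => (hr i).const_mul _

lemma linearMap_rat_eq {φ : ℝ →ₗ[ℚ] ℚ} (h : φ 1 = 1) (q : ℚ) : φ q = q := by
  have := φ.map_smul q 1
  rwa [h, Rat.smul_def, mul_one, smul_eq_mul, mul_one] at this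

/-- All values of the function are rational. -/
def RationalValued (Q : A → ℝ) : Prop := ∃ q : A → ℚ, ∀ a, Q a = q a

lemma empirical_rationalValued (x : Fin n → A) : RationalValued (empirical x) :=
  ⟨fun a => (letterCount x a : ℚ) / n, fun a => by rw [empirical_apply]; push_cast; rfl⟩

lemma margY_ratApprox [Fintype X] (φ : ℝ →ₗ[ℚ] ℚ) (Q : X × Y → ℝ) :
    margY (fun z => (φ (Q z) : ℝ)) = fun y => (φ (margY Q y) : ℝ) := by
  funext y
  simp only [margY]
  rw [← Rat.cast_sum, ← map_sum]

section Approx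

variable [Fintype X] [Fintype Y]

/-- Linear relations with rational data hold exactly for every `k`. Only nonnegativity needs large
`k`: zero entries stay zero and positive ones become positive in the limit. -/
lemma eventually_ratApprox_mem_jointWith {P : X → ℝ} (hP : RationalValued P)
    {φ : ℕ → ℝ →ₗ[ℚ] ℚ} (h1 : ∀ k, φ k 1 = 1)
    (hlim : ∀ v, Tendsto (fun k => (φ k v : ℝ)) atTop (𝓝 v)) {Q : X × Y → ℝ}
    (hQ : Q ∈ jointWith Y P) : ∀ᶠ k in atTop, (fun z => (φ k (Q z) : ℝ)) ∈ jointWith Y P := by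
  have hpos : ∀ z, ∀ᶠ k in atTop, (0 : ℝ) ≤ φ k (Q z) := fun z => by
    rcases (hQ.1.1 z).eq_or_lt with h | h
    · simp [← h]
    · exact ((hlim (Q z)).eventually (lt_mem_nhds h)).mono fun _ h => h.le
  filter_upwards [eventually_all.2 hpos] with k hk
  refine ⟨⟨hk, ?_⟩, ?_⟩
  · rw [← Rat.cast_sum, ← map_sum, hQ.1.2, h1, Rat.cast_one]
  · obtain ⟨p, hp⟩ := hP
    funext x
    have : margX Q x = P x := by rw [hQ.2]
    simp only [margX] at this ⊢
    rw [← Rat.cast_sum, ← map_sum, this, hp, linearMap_rat_eq (h1 k)]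

lemma logLik_ratApprox_ne_bot {W : X → Y → ℝ} {Q : X × Y → ℝ} (hQ : ∀ z, 0 ≤ Q z)
    (h : logLik W Q ≠ ⊥) (φ : ℝ →ₗ[ℚ] ℚ) : logLik W (fun z => (φ (Q z) : ℝ)) ≠ ⊥ := by
  rw [logLik_ne_bot_iff] at h ⊢
  intro x y hw
  rw [le_antisymm (h x y hw) (hQ _)]
  simp

end Approx

/-! ### Vectors with a prescribed type -/

lemma exists_mul_eq_natCast [Fintype A] {Q : A → ℝ} (h0 : ∀ a, 0 ≤ Q a) (hQ : RationalValued Q) :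
    ∃ N : ℕ, 0 < N ∧ ∃ k : A → ℕ, ∀ a, Q a * N = k a := by
  obtain ⟨q, hq⟩ := hQ
  -- The product of all denominators serves as common denominator.
  refine ⟨∏ a, (q a).den, Finset.prod_pos fun a _ => (q a).den_pos,
    fun a => (q a).num.toNat * ∏ b ∈ Finset.univ.erase a, (q b).den, fun a => ?_⟩
  have hqa : 0 ≤ q a := by
    have := h0 a
    rw [hq] at this
    exact_mod_cast this
  have hnum : (((q a).num.toNat : ℕ) : ℝ) = ((q a).num : ℝ) := by
    have := Int.toNat_of_nonneg (Rat.num_nonneg.2 hqa)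
    exact_mod_cast this
  have hden : ((q a).den : ℝ) ≠ 0 := by exact_mod_cast (q a).den_nz
  rw [← Finset.mul_prod_erase _ _ (Finset.mem_univ a), Nat.cast_mul, Nat.cast_mul, hnum, hq,
    ← mul_assoc, Rat.cast_def, div_mul_cancel₀ _ hden]

lemma exists_letterCount_eq [Fintype A] (k : A → ℕ) (hk : ∑ a, k a = n) :
    ∃ z : Fin n → A, ∀ a, letterCount z a = k a := by
  have e : Fin n ≃ Σ a, Fin (k a) := Fintype.equivOfCardEq (by simp [hk])
  refine ⟨fun i => (e i).1, fun a => ?_⟩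
  have : Fintype.card {i : Fin n // (e i).1 = a} = Fintype.card (Fin (k a)) :=
    Fintype.card_congr ((e.subtypeEquiv fun _ => Iff.rfl).trans (Equiv.sigmaSubtype a))
  rw [Fintype.card_subtype, Fintype.card_fin] at this
  exact this

lemma exists_typeClass_nonempty [Fintype A] {Q : A → ℝ} (hQ : Q ∈ stdSimplex ℝ A)
    (hr : RationalValued Q) : ∃ N : ℕ, 0 < N ∧ ∀ j, 0 < j → (typeClass (N * j) Q).Nonempty := by
  obtain ⟨N, hN, k, hk⟩ := exists_mul_eq_natCast hQ.1 hr
  refine ⟨N, hN, fun j hj => ?_⟩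
  have hsum : ∑ a, k a * j = N * j := by
    rw [← Finset.sum_mul]
    congr 1
    have : ((∑ a, k a : ℕ) : ℝ) = N := by
      push_cast
      rw [← Finset.sum_congr rfl fun a _ => hk a, ← Finset.sum_mul, hQ.2, one_mul]
    exact_mod_cast this
  obtain ⟨z, hz⟩ := exists_letterCount_eq _ hsum
  refine ⟨z, mem_typeClass.2 ?_⟩
  funext a
  rw [empirical_apply, hz]
  push_cast
  rw [← hk]
  field_simp

/-! ### Limits of normalized logarithms -/

lemma normNegLog_ge {k : ℕ} {c p : ℝ} (hn : 0 < n) (hp : 0 ≤ p)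
    (h : p ≤ ((n : ℝ) + 1) ^ k * Real.exp (-(n * c))) :
    ((c - k * (Real.log (n + 1) / n) : ℝ) : EReal) ≤ normNegLog n p := by
  have hn' : (0 : ℝ) < n := by exact_mod_cast hn
  rw [normNegLog]
  split_ifs with h0
  · exact le_top
  · rw [EReal.coe_le_coe_iff]
    have hp' : 0 < p := lt_of_le_of_ne hp (Ne.symm h0)
    have h1 := Real.log_le_log hp' h
    rw [Real.log_mul (by positivity) (Real.exp_ne_zero _), Real.log_exp, Real.log_pow] at h1
    have h2 : c - k * (Real.log (n + 1) / n) = (n * c - k * Real.log (n + 1)) / n := by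
      field_simp
    have h3 : -(1 / (n : ℝ)) * Real.log p = (-Real.log p) / n := by
      field_simp
    rw [h2, h3]
    gcongr
    linarith

lemma normNegLog_le {k : ℕ} {c p : ℝ} (hn : 0 < n)
    (h : Real.exp (-(n * c)) ≤ ((n : ℝ) + 1) ^ k * p) :
    normNegLog n p ≤ ((c + k * (Real.log (n + 1) / n) : ℝ) : EReal) := by
  have hn' : (0 : ℝ) < n := by exact_mod_cast hn
  have hp : 0 < p := pos_of_mul_pos_right ((Real.exp_pos _).trans_le h) (by positivity)
  rw [normNegLog, if_neg hp.ne', EReal.coe_le_coe_iff]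
  have h1 := Real.log_le_log (Real.exp_pos _) h
  rw [Real.log_mul (by positivity) hp.ne', Real.log_exp, Real.log_pow] at h1
  have h2 : c + k * (Real.log (n + 1) / n) = (n * c + k * Real.log (n + 1)) / n := by
    field_simp
  have h3 : -(1 / (n : ℝ)) * Real.log p = (-Real.log p) / n := by
    field_simp
  rw [h2, h3]
  gcongr
  linarith

lemma tendsto_log_succ_div (k : ℕ) :
    Tendsto (fun n : ℕ => (k : ℝ) * (Real.log (n + 1) / n)) atTop (𝓝 0) := by
  have h1 : Tendsto (fun x : ℝ => Real.log x / x) atTop (𝓝 0) :=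
    Real.isLittleO_log_id_atTop.tendsto_div_nhds_zero
  have h2 : Tendsto (fun n : ℕ => (n : ℝ) + 1) atTop atTop :=
    tendsto_atTop_add_const_right _ _ tendsto_natCast_atTop_atTop
  have h3 : Tendsto (fun n : ℕ => ((n : ℝ) + 1) / n) atTop (𝓝 1) := by
    have : Tendsto (fun n : ℕ => 1 + 1 / (n : ℝ)) atTop (𝓝 (1 + 0)) :=
      tendsto_one_div_atTop_nhds_zero_nat.const_add 1
    rw [add_zero] at this
    refine this.congr' ?_
    filter_upwards [eventually_gt_atTop 0] with n hn
    field_simp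
  have h4 := ((h1.comp h2).mul h3).const_mul (k : ℝ)
  rw [zero_mul, mul_zero] at h4
  refine h4.congr fun n => ?_
  simp only [Function.comp]
  have : (n : ℝ) + 1 ≠ 0 := by positivity
  field_simp

lemma le_liminf_of_forall_real {v : EReal} {F : Filter ℕ} {u : ℕ → EReal} {δ : ℕ → ℝ}
    (hδ : Tendsto δ F (𝓝 0))
    (h : ∀ c : ℝ, (c : EReal) ≤ v → ∀ᶠ n in F, ((c - δ n : ℝ) : EReal) ≤ u n) :
    v ≤ liminf u F := by
  refine le_of_forall_lt fun z hz => ?_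
  obtain ⟨c, hzc, hcv⟩ := EReal.lt_iff_exists_real_btwn.1 hz
  obtain ⟨c', hzc', hcc'⟩ := EReal.lt_iff_exists_real_btwn.1 hzc
  refine hzc'.trans_le (le_liminf_of_le (by isBoundedDefault) ?_)
  -- The gap between the two real numbers below `v` absorbs the vanishing correction `δ`.
  have hcc : 0 < c - c' := sub_pos.2 (EReal.coe_lt_coe_iff.1 hcc')
  filter_upwards [h c hcv.le, hδ.eventually (gt_mem_nhds hcc)] with n h1 h2
  refine le_trans ?_ h1
  rw [EReal.coe_le_coe_iff]
  linarith

lemma liminf_le_of_subseq {v : ℝ} {F : Filter ℕ} {u : ℕ → EReal} {δ : ℕ → ℝ} {m : ℕ → ℕ}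
    (hm : Tendsto m atTop F) (hδ : Tendsto δ atTop (𝓝 0))
    (h : ∀ᶠ j in atTop, u (m j) ≤ ((v + δ j : ℝ) : EReal)) : liminf u F ≤ v := by
  calc liminf u F ≤ liminf u (map m atTop) := liminf_le_liminf_of_le hm
    _ = liminf (u ∘ m) atTop := rfl
    _ ≤ liminf (fun j => ((v + δ j : ℝ) : EReal)) atTop := liminf_le_liminf h
    _ = v := by
      refine Tendsto.liminf_eq ?_
      have := hδ.const_add v
      rw [add_zero] at this
      exact (continuous_coe_real_ereal.tendsto v).comp this

/-! ### Bounds on the exponents -/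

lemma errorProb_nonneg [Fintype Y] {W : X → Y → ℝ} (hW : ∀ x y, 0 ≤ W x y) {M : ℕ} (C : Fin M → Fin n → X)
    (D : Fin M → Set (Fin n → Y)) : 0 ≤ errorProb W C D :=
  mul_nonneg (by positivity) (Finset.sum_nonneg fun m _ => Finset.sum_nonneg fun y _ => by
    split_ifs
    exacts [le_rfl, channelProb_nonneg hW _ _])

lemma listSize_nonneg [Fintype Y] {W : X → Y → ℝ} (hW : ∀ x y, 0 ≤ W x y) {M : ℕ} (C : Fin M → Fin n → X)
    (D : Fin M → Set (Fin n → Y)) : 0 ≤ listSize W C D :=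
  Finset.sum_nonneg fun y _ => mul_nonneg (by positivity) (Finset.sum_nonneg fun m _ =>
    mul_nonneg (channelProb_nonneg hW _ _) (Finset.sum_nonneg fun l _ => by
      split_ifs <;> norm_num))

section Exponents

variable [Fintype X] [Fintype Y]

lemma codebookSize_pos {R : ℝ} (hR : 0 < R) (n : ℕ) : 0 < codebookSize R n := by
  rw [codebookSize, Nat.floor_pos]
  exact Real.one_le_exp (by positivity)

lemma codebookSize_le (R : ℝ) (n : ℕ) : (codebookSize R n : ℝ) ≤ Real.exp (n * R) :=
  Nat.floor_le (Real.exp_nonneg _)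

lemma eventually_exp_le_codebookSize {R : ℝ} (hR : 0 < R) :
    ∀ᶠ n : ℕ in atTop, Real.exp (n * R) ≤ 2 * ((codebookSize R n : ℝ) - 1) := by
  have h : Tendsto (fun n : ℕ => Real.exp (n * R)) atTop atTop :=
    Real.tendsto_exp_atTop.comp (tendsto_natCast_atTop_atTop.atTop_mul_const hR)
  -- Since `M > exp(n R) - 1`, one has `2 (M - 1) > 2 exp(n R) - 4`, and `4` is where this reaches
  -- `exp(n R)`.
  filter_upwards [h.eventually_ge_atTop 4] with n hn
  have := Nat.lt_floor_add_one (Real.exp (n * R))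
  rw [← codebookSize] at this
  linarith

lemma ensembleAvg_nonneg {P : X → ℝ} {M : ℕ} {F : (Fin M → Fin n → X) → ℝ} (hF : ∀ C, 0 ≤ F C) :
    0 ≤ ensembleAvg P n M F :=
  div_nonneg (Finset.sum_nonneg fun C _ => hF C) (by positivity)

lemma eventually_blockLengths (P : X → ℝ) :
    ∀ᶠ n in blockLengths P, 0 < n ∧ (typeClass n P).Nonempty :=
  ((eventually_gt_atTop 0).filter_mono inf_le_left).and (mem_inf_of_right (mem_principal_self _))

lemma le_errorExponent {W : X → Y → ℝ} (hW : ∀ x y, 0 ≤ W x y) (P : X → ℝ) {R : ℝ} (hR : 0 < R)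
    (g : OutputThreshold Y) :
    ⨅ Q ∈ errorSetStrict W P g, errorObjective W P Q ≤
      errorExponent W P R (thresholdDecoder W g) := by
  refine le_liminf_of_forall_real ((tendsto_log_succ_div
    (Fintype.card X + (Fintype.card Y + Fintype.card (X × Y)))).mono_left inf_le_left)
    fun c hc => ?_
  filter_upwards [eventually_blockLengths P] with n ⟨hn, hT⟩
  exact normNegLog_ge hn (ensembleAvg_nonneg fun C => errorProb_nonneg hW _ _)
    (ensembleAvg_errorProb_le hW hn hT (codebookSize_pos hR n)
      fun Q hQ => hc.trans (iInf₂_le Q hQ))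

lemma le_listExponent {W : X → Y → ℝ} (hW : ∀ x y, 0 ≤ W x y) (P : X → ℝ) {R : ℝ} (hR : 0 < R)
    (g : OutputThreshold Y) :
    ⨅ p ∈ pairsOver P (listFeasible W P g), listObjective W P R p ≤
      listExponent W P R (thresholdDecoder W g) := by
  refine le_liminf_of_forall_real ((tendsto_log_succ_div
    (2 * (Fintype.card X + Fintype.card Y + Fintype.card (X × Y)))).mono_left inf_le_left)
    fun c hc => ?_
  filter_upwards [eventually_blockLengths P] with n ⟨hn, hT⟩
  exact normNegLog_ge hn (ensembleAvg_nonneg fun C => listSize_nonneg hW _ _)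
    (ensembleAvg_listSize_le hW hn hT (codebookSize_pos hR n) (codebookSize_le R n)
      fun p hp => hc.trans (iInf₂_le p hp))

lemma tendsto_mul_succ_atTop {N : ℕ} (hN : 0 < N) :
    Tendsto (fun j => N * (j + 1)) atTop (atTop : Filter ℕ) :=
  tendsto_atTop_mono (fun j => j.le_succ.trans (Nat.le_mul_of_pos_left _ hN)) tendsto_id

lemma tendsto_blockLengths {P : X → ℝ} {N : ℕ} (hN : 0 < N)
    (h : ∀ j, (typeClass (N * (j + 1)) P).Nonempty) :
    Tendsto (fun j => N * (j + 1)) atTop (blockLengths P) :=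
  tendsto_inf.2 ⟨tendsto_mul_succ_atTop hN, tendsto_principal.2 (Eventually.of_forall h)⟩

/-- At multiples of a common denominator `Q` is itself a joint type, so a single class already
bounds the error probability from below. -/
lemma errorExponent_le_of_rationalValued {W : X → Y → ℝ} (hW : ∀ x y, 0 ≤ W x y) {P : X → ℝ}
    {R : ℝ} (hR : 0 < R) {g : OutputThreshold Y} {Q : X × Y → ℝ} (hQ : Q ∈ errorSetStrict W P g)
    (hb : logLik W Q ≠ ⊥) (hr : RationalValued Q) :
    errorExponent W P R (thresholdDecoder W g) ≤ (condDivReal W P Q : ℝ) := by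
  obtain ⟨N, hN, hT⟩ := exists_typeClass_nonempty hQ.1.1 hr
  choose z hz using fun j : ℕ => hT (j + 1) j.succ_pos
  have hjoint : ∀ j, jointEmpirical (fun i => (z j i).1) (fun i => (z j i).2) = Q :=
    fun j => mem_typeClass.1 (hz j)
  have hx : ∀ j, (fun i => (z j i).1) ∈ typeClass (N * (j + 1)) P := fun j => by
    rw [mem_typeClass, ← margX_jointEmpirical _ (fun i => (z j i).2), hjoint, hQ.1.2]
  refine liminf_le_of_subseq (tendsto_blockLengths hN fun j => ⟨_, hx j⟩)
    ((tendsto_log_succ_div (Fintype.card (X × Y))).comp (tendsto_mul_succ_atTop hN))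
    (Eventually.of_forall fun j => ?_)
  have hn : 0 < N * (j + 1) := by positivity
  have hacc : ¬ Accepts W g (fun i => (z j i).1) (fun i => (z j i).2) := by
    rw [Accepts, ← margY_jointEmpirical (fun i => (z j i).1), hjoint, not_le]
    exact hQ.2
  have := le_ensembleAvg_errorProb hW hn (codebookSize_pos hR (N * (j + 1)))
    (hx j) hacc (by rwa [hjoint])
  rw [hjoint] at this
  exact normNegLog_le hn this

/-- Both output components have the same type, so permuting the positions of one pair aligns them.
-/
lemma exists_common_output {Q Q' : X × Y → ℝ} (h : margY Q' = margY Q)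
    (hQ : (typeClass n Q).Nonempty) (hQ' : (typeClass n Q').Nonempty) :
    ∃ (x x' : Fin n → X) (y : Fin n → Y), jointEmpirical x y = Q ∧ jointEmpirical x' y = Q' := by
  obtain ⟨z, hz⟩ := hQ
  obtain ⟨z', hz'⟩ := hQ'
  rw [mem_typeClass] at hz hz'
  have h1 : empirical (fun i => (z i).2) = empirical (fun i => (z' i).2) := by
    rw [← margY_jointEmpirical (fun i => (z i).1), ← margY_jointEmpirical (fun i => (z' i).1)]
    exact (congrArg margY hz).trans (h.symm.trans (congrArg margY hz').symm)
  obtain ⟨σ, hσ⟩ := exists_perm_of_empirical_eq h1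
  refine ⟨fun i => (z i).1, fun i => (z' (σ i)).1, fun i => (z i).2, hz, ?_⟩
  rw [← hσ, ← hz', ← empirical_comp_perm z' σ]
  rfl

/-- The factor `2` lost in passing from `exp(n R)` to `M - 1` is paid by one more power of `n + 1 ≥
2`. -/
lemma exp_le_of_exp_le_codebookSize {k : ℕ} {M D I R p : ℝ} (hn : 0 < n)
    (hM : Real.exp (n * R) ≤ 2 * (M - 1))
    (h : (M - 1) * Real.exp (-(n * (D + I))) ≤ ((n : ℝ) + 1) ^ k * p) :
    Real.exp (-(n * (D + (I - R)))) ≤ ((n : ℝ) + 1) ^ (k + 1) * p := by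
  have h2 : (2 : ℝ) ≤ (n : ℝ) + 1 := by
    have : (1 : ℝ) ≤ n := by exact_mod_cast hn
    linarith
  have h3 := (mul_nonneg (by linarith [Real.exp_nonneg (n * R)]) (Real.exp_nonneg _)).trans h
  calc _ = Real.exp (n * R) * Real.exp (-(n * (D + I))) := by
        rw [← Real.exp_add]
        congr 1
        ring
    _ ≤ 2 * (M - 1) * Real.exp (-(n * (D + I))) := by gcongr
    _ ≤ 2 * (((n : ℝ) + 1) ^ k * p) := by
        rw [mul_assoc]
        exact mul_le_mul_of_nonneg_left h (by norm_num)
    _ ≤ ((n : ℝ) + 1) * (((n : ℝ) + 1) ^ k * p) := mul_le_mul_of_nonneg_right h2 h3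
    _ = _ := by
        rw [pow_succ]
        ring

lemma listExponent_le_of_rationalValued {W : X → Y → ℝ} (hW : ∀ x y, 0 ≤ W x y) {P : X → ℝ}
    {R : ℝ} (hR : 0 < R) {g : OutputThreshold Y} {Q Q' : X × Y → ℝ} (hQ : Q ∈ jointWith Y P)
    (hb : logLik W Q ≠ ⊥) (hQ' : Q' ∈ listFeasible W P g) (hY : margY Q' = margY Q)
    (hr : RationalValued Q) (hr' : RationalValued Q') :
    listExponent W P R (thresholdDecoder W g) ≤
      (condDivReal W P Q + (mutualInfo Q' - R) : ℝ) := by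
  obtain ⟨N₁, hN₁, hT₁⟩ := exists_typeClass_nonempty hQ.1 hr
  obtain ⟨N₂, hN₂, hT₂⟩ := exists_typeClass_nonempty hQ'.1.1 hr'
  -- Both distributions must be types at the same block length, hence the product of the two
  -- denominators.
  have hN : 0 < N₁ * N₂ := Nat.mul_pos hN₁ hN₂
  have hex : ∀ j : ℕ, ∃ (x x' : Fin (N₁ * N₂ * (j + 1)) → X) (y : Fin (N₁ * N₂ * (j + 1)) → Y),
      jointEmpirical x y = Q ∧ jointEmpirical x' y = Q' := fun j => by
    refine exists_common_output hY ?_ ?_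
    · rw [mul_assoc]
      exact hT₁ _ (by positivity)
    · rw [mul_comm N₁, mul_assoc]
      exact hT₂ _ (by positivity)
  choose x x' y hjoint hjoint' using hex
  have hx : ∀ j, x j ∈ typeClass (N₁ * N₂ * (j + 1)) P := fun j => by
    rw [mem_typeClass, ← margX_jointEmpirical _ (y j), hjoint, hQ.2]
  have hx' : ∀ j, x' j ∈ typeClass (N₁ * N₂ * (j + 1)) P := fun j => by
    rw [mem_typeClass, ← margX_jointEmpirical _ (y j), hjoint', hQ'.1.2]
  refine liminf_le_of_subseq (tendsto_blockLengths hN fun j => ⟨_, hx j⟩)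
    ((tendsto_log_succ_div (2 * Fintype.card (X × Y) + 1)).comp (tendsto_mul_succ_atTop hN)) ?_
  filter_upwards [(tendsto_mul_succ_atTop hN).eventually (eventually_exp_le_codebookSize hR)]
    with j hM
  have hn : 0 < N₁ * N₂ * (j + 1) := by positivity
  have hacc : Accepts W g (x' j) (y j) := by
    rw [Accepts, ← margY_jointEmpirical (x' j), hjoint']
    exact hQ'.2
  have := le_ensembleAvg_listSize hW hn (codebookSize_pos hR (N₁ * N₂ * (j + 1)))
    (hx j) (hx' j) hacc (by rwa [hjoint])
  rw [hjoint, hjoint'] at this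
  exact normNegLog_le hn (exp_le_of_exp_le_codebookSize hn hM this)

end Exponents

/-! ### Semicontinuity of the threshold -/

section Threshold

variable [Fintype Y]

lemma OutputThreshold.eval_of_mem {g : OutputThreshold Y} {q : Y → ℝ} (h : q ∈ g.dom) :
    g.eval q = (g.val q : ℝ) := if_pos h

lemma OutputThreshold.eval_of_notMem {g : OutputThreshold Y} {q : Y → ℝ} (h : q ∉ g.dom) :
    g.eval q = ⊤ := if_neg h

lemma OutputThreshold.mem_dom_of_eval_ne_top {g : OutputThreshold Y} {q : Y → ℝ}
    (h : g.eval q ≠ ⊤) : q ∈ g.dom := by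
  by_contra hq
  exact h (eval_of_notMem hq)

lemma OutputThreshold.eval_ne_bot (g : OutputThreshold Y) (q : Y → ℝ) : g.eval q ≠ ⊥ := by
  by_cases h : q ∈ g.dom
  · rw [eval_of_mem h]; exact EReal.coe_ne_bot _
  · rw [eval_of_notMem h]; exact bot_lt_top.ne'

/-- Lower semicontinuity of the extended threshold: leaving the domain only raises `g` to `+∞`, and
the complement of the closed domain is open. -/
lemma OutputThreshold.eventually_lt_eval {ι : Type*} {F : Filter ι} {g : OutputThreshold Y}
    {q : ι → Y → ℝ} {q₀ : Y → ℝ} (hq : Tendsto q F (𝓝 q₀)) {t : ι → ℝ} {t₀ : ℝ}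
    (ht : Tendsto t F (𝓝 t₀)) (h : (t₀ : EReal) < g.eval q₀) :
    ∀ᶠ i in F, (t i : EReal) < g.eval (q i) := by
  by_cases hmem : q₀ ∈ g.dom
  · rw [eval_of_mem hmem, EReal.coe_lt_coe_iff] at h
    obtain ⟨m, h1, h2⟩ := exists_between h
    have h3 := eventually_nhdsWithin_iff.1
      ((g.val_continuousOn q₀ hmem).eventually (lt_mem_nhds h2))
    filter_upwards [hq.eventually h3, ht.eventually (gt_mem_nhds h1)] with i h4 h5
    by_cases hi : q i ∈ g.dom
    · rw [eval_of_mem hi, EReal.coe_lt_coe_iff]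
      exact h5.trans (h4 hi)
    · rw [eval_of_notMem hi]
      exact EReal.coe_lt_top _
  · filter_upwards [hq.eventually (g.dom_compact.isClosed.isOpen_compl.mem_nhds hmem)] with i hi
    rw [eval_of_notMem hi]
    exact EReal.coe_lt_top _

/-- For upper bounds on `g` the approximants must stay in the domain, which the relative interior
condition guarantees. -/
lemma OutputThreshold.eventually_eval_lt {ι : Type*} {F : Filter ι} {g : OutputThreshold Y}
    {q : ι → Y → ℝ} {q₀ : Y → ℝ} (hq : Tendsto q F (𝓝 q₀))
    (hs : ∀ᶠ i in F, q i ∈ stdSimplex ℝ Y) (hdom : g.dom ∈ 𝓝[stdSimplex ℝ Y] q₀) {t : ι → ℝ}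
    {t₀ : ℝ} (ht : Tendsto t F (𝓝 t₀)) (h : g.eval q₀ < t₀) :
    ∀ᶠ i in F, g.eval (q i) < t i := by
  have hmem : q₀ ∈ g.dom := mem_dom_of_eval_ne_top (h.trans (EReal.coe_lt_top _)).ne
  rw [eval_of_mem hmem, EReal.coe_lt_coe_iff] at h
  obtain ⟨m, h1, h2⟩ := exists_between h
  have h3 := eventually_nhdsWithin_iff.1
    ((g.val_continuousOn q₀ hmem).eventually (gt_mem_nhds h1))
  have h4 : ∀ᶠ i in F, q i ∈ g.dom := (tendsto_nhdsWithin_iff.2 ⟨hq, hs⟩).eventually hdom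
  filter_upwards [hq.eventually h3, ht.eventually (lt_mem_nhds h2), h4] with i h5 h6 h7
  rw [eval_of_mem h7, EReal.coe_lt_coe_iff]
  exact (h5 h7).trans h6

end Threshold

/-! ### Compactness of the distributions and the list objective as a continuous function -/

section Main

variable [Fintype X] [Fintype Y]

lemma margY_mem_stdSimplex {P : X → ℝ} {Q : X × Y → ℝ} (hQ : Q ∈ jointWith Y P) :
    margY Q ∈ stdSimplex ℝ Y := by
  refine ⟨fun y => Finset.sum_nonneg fun x _ => hQ.1.1 _, ?_⟩
  rw [← hQ.1.2, Fintype.sum_prod_type, Finset.sum_comm]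
  rfl

lemma isClosed_jointWith (P : X → ℝ) : IsClosed (jointWith Y P) :=
  (isClosed_stdSimplex _ _).inter (isClosed_eq continuous_margX continuous_const)

lemma isCompact_jointWith (P : X → ℝ) : IsCompact (jointWith Y P) :=
  (isCompact_stdSimplex ℝ (X × Y)).of_isClosed_subset (isClosed_jointWith P) fun _ h => h.1

lemma logLik_ne_bot_of_mem_listFeasible {W : X → Y → ℝ} {P : X → ℝ} {g : OutputThreshold Y}
    {Q : X × Y → ℝ} (h : Q ∈ listFeasible W P g) : logLik W Q ≠ ⊥ := fun hb =>
  g.eval_ne_bot _ (le_bot_iff.1 (h.2.trans_eq hb))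

lemma listFeasibleStrict_subset (W : X → Y → ℝ) (P : X → ℝ) (g : OutputThreshold Y) :
    listFeasibleStrict W P g ⊆ listFeasible W P g := fun _ h => ⟨h.1, h.2.2.le⟩

/-- The real-valued part of the objective of the list size problem. -/
def listObjectiveReal (W : X → Y → ℝ) (P : X → ℝ) (R : ℝ) (p : (X × Y → ℝ) × (X × Y → ℝ)) : ℝ :=
  condDivReal W P p.1 + (entropy P + entropy (margY p.2) - entropy p.2 - R)

lemma continuous_listObjectiveReal (W : X → Y → ℝ) (P : X → ℝ) (R : ℝ) :
    Continuous (listObjectiveReal W P R) := by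
  unfold listObjectiveReal
  exact ((continuous_condDivReal W P).comp continuous_fst).add
    (((continuous_const.add (continuous_entropy.comp (continuous_margY.comp continuous_snd))).sub
      (continuous_entropy.comp continuous_snd)).sub continuous_const)

lemma listObjective_of_ne_bot {W : X → Y → ℝ} {P : X → ℝ} {R : ℝ}
    {p : (X × Y → ℝ) × (X × Y → ℝ)} (h1 : p.1 ∈ jointWith Y P) (h2 : p.2 ∈ jointWith Y P)
    (hb : logLik W p.1 ≠ ⊥) : listObjective W P R p = (listObjectiveReal W P R p : ℝ) := by
  have e : listObjective W P R p =
      errorObjective W P p.1 + ((mutualInfo p.2 - R : ℝ) : EReal) := rfl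
  rw [e, errorObjective_of_ne_bot h1 hb, ← EReal.coe_add, mutualInfo_eq h2]
  rfl

lemma listObjective_of_eq_bot {W : X → Y → ℝ} {P : X → ℝ} {R : ℝ}
    {p : (X × Y → ℝ) × (X × Y → ℝ)} (h1 : p.1 ∈ jointWith Y P)
    (hb : logLik W p.1 = ⊥) : listObjective W P R p = ⊤ := by
  have e : listObjective W P R p =
      errorObjective W P p.1 + ((mutualInfo p.2 - R : ℝ) : EReal) := rfl
  rw [e, errorObjective_of_eq_bot h1 hb, EReal.top_add_coe]

lemma rationalValued_of_typeClass_nonempty {P : X → ℝ} (h : (typeClass n P).Nonempty) :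
    RationalValued P := by
  obtain ⟨x, hx⟩ := h
  rw [← mem_typeClass.1 hx]
  exact empirical_rationalValued x

/-! ### Single-letter upper bounds on the exponents -/

lemma errorExponent_le {W : X → Y → ℝ} (hW : ∀ x y, 0 ≤ W x y) {P : X → ℝ}
    (hP : RationalValued P) {R : ℝ} (hR : 0 < R) (g : OutputThreshold Y) :
    errorExponent W P R (thresholdDecoder W g) ≤
      ⨅ Q ∈ errorSetStrict W P g, errorObjective W P Q := by
  refine le_iInf₂ fun Q hQ => ?_
  by_cases hb : logLik W Q = ⊥
  · rw [errorObjective_of_eq_bot hQ.1 hb]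
    exact le_top
  rw [errorObjective_of_ne_bot hQ.1 hb]
  obtain ⟨φ, h1, hlim⟩ := exists_rat_linear_approx
  have hQlim : Tendsto (fun k z => (φ k (Q z) : ℝ)) atTop (𝓝 Q) :=
    tendsto_pi_nhds.2 fun z => hlim (Q z)
  have hlt := hQ.2
  rw [logLik_of_ne_bot hb] at hlt
  have hev := OutputThreshold.eventually_lt_eval ((continuous_margY.tendsto Q).comp hQlim)
    (((continuous_logLikReal W).tendsto Q).comp hQlim) hlt
  have hlimD := (continuous_coe_real_ereal.tendsto _).comp
    (((continuous_condDivReal W P).tendsto Q).comp hQlim)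
  -- The bound holds for the rational approximants of `Q`, whose objectives converge to that of `Q`.
  refine ge_of_tendsto hlimD ?_
  filter_upwards [hev, eventually_ratApprox_mem_jointWith hP h1 hlim hQ.1] with k hk hmem
  have hbk := logLik_ratApprox_ne_bot hQ.1.1.1 hb (φ k)
  refine errorExponent_le_of_rationalValued hW hR ⟨hmem, ?_⟩ hbk ⟨fun z => φ k (Q z), fun _ => rfl⟩
  rw [logLik_of_ne_bot hbk]
  exact hk

lemma listExponent_le {W : X → Y → ℝ} (hW : ∀ x y, 0 ≤ W x y) {P : X → ℝ}
    (hP : RationalValued P) {R : ℝ} (hR : 0 < R) (g : OutputThreshold Y) :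
    listExponent W P R (thresholdDecoder W g) ≤
      ⨅ p ∈ pairsOver P (listFeasibleStrict W P g), listObjective W P R p := by
  refine le_iInf₂ fun p hp => ?_
  obtain ⟨hQ, hQ', hY⟩ := hp
  by_cases hb : logLik W p.1 = ⊥
  · rw [listObjective_of_eq_bot hQ hb]
    exact le_top
  rw [listObjective_of_ne_bot hQ hQ'.1 hb]
  have hb' : logLik W p.2 ≠ ⊥ :=
    logLik_ne_bot_of_mem_listFeasible (listFeasibleStrict_subset W P g hQ')
  obtain ⟨φ, h1, hlim⟩ := exists_rat_linear_approx
  have hQlim : Tendsto (fun k z => (φ k (p.1 z) : ℝ)) atTop (𝓝 p.1) :=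
    tendsto_pi_nhds.2 fun z => hlim _
  have hQlim' : Tendsto (fun k z => (φ k (p.2 z) : ℝ)) atTop (𝓝 p.2) :=
    tendsto_pi_nhds.2 fun z => hlim _
  have hmem := eventually_ratApprox_mem_jointWith hP h1 hlim hQ
  have hmem' := eventually_ratApprox_mem_jointWith hP h1 hlim hQ'.1
  have hlt := hQ'.2.2
  rw [logLik_of_ne_bot hb'] at hlt
  have hev := OutputThreshold.eventually_eval_lt ((continuous_margY.tendsto p.2).comp hQlim')
    (hmem'.mono fun k hk => margY_mem_stdSimplex hk) hQ'.2.1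
    (((continuous_logLikReal W).tendsto p.2).comp hQlim') hlt
  have hlimD := (continuous_coe_real_ereal.tendsto _).comp
    (((continuous_listObjectiveReal W P R).tendsto p).comp (hQlim.prodMk_nhds hQlim'))
  refine ge_of_tendsto hlimD ?_
  filter_upwards [hev, hmem, hmem'] with k hk hm hm'
  have hbk := logLik_ratApprox_ne_bot hQ.1.1 hb (φ k)
  have hbk' := logLik_ratApprox_ne_bot hQ'.1.1.1 hb' (φ k)
  have := listExponent_le_of_rationalValued (g := g) hW hR hm hbk ⟨hm', ?_⟩ ?_
    ⟨fun z => φ k (p.1 z), fun _ => rfl⟩ ⟨fun z => φ k (p.2 z), fun _ => rfl⟩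
  · rw [mutualInfo_eq hm'] at this
    exact this
  · rw [logLik_of_ne_bot hbk']
    exact hk.le
  -- One additive map rounds both distributions, so the two output marginals agree exactly.
  · rw [margY_ratApprox, margY_ratApprox, hY]

/-! ### Regularity and attainment -/

/-- The objective is real and continuous on the compact part `K` and infinite elsewhere on `S`. If
`K` is empty but `S` is not, every point of `S` attains the minimum `⊤`. -/
lemma isMinOver_biInf {α : Type*} [TopologicalSpace α] {φ : α → EReal} {S K : Set α} {h : α → ℝ}
    (hsub : K ⊆ S) (hK : IsCompact K) (hcont : Continuous h) (hφ : ∀ p ∈ K, φ p = h p)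
    (htop : ∀ p ∈ S, p ∉ K → φ p = ⊤) : IsMinOver φ S (⨅ p ∈ S, φ p) := by
  rcases S.eq_empty_or_nonempty with rfl | ⟨p₀, hp₀⟩
  · exact Or.inr ⟨rfl, by simp⟩
  have hmin : ∃ p ∈ S, ∀ p' ∈ S, φ p ≤ φ p' := by
    rcases K.eq_empty_or_nonempty with rfl | hne
    · exact ⟨p₀, hp₀, fun p' hp' => by rw [htop p' hp' (Set.notMem_empty _)]; exact le_top⟩
    · obtain ⟨p, hp, hpmin⟩ := hK.exists_isMinOn hne hcont.continuousOn
      refine ⟨p, hsub hp, fun p' hp' => ?_⟩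
      by_cases hk : p' ∈ K
      · rw [hφ p hp, hφ p' hk, EReal.coe_le_coe_iff]
        exact hpmin hk
      · rw [htop p' hp' hk]
        exact le_top
  obtain ⟨p, hp, hpmin⟩ := hmin
  have : ⨅ p ∈ S, φ p = φ p := le_antisymm (iInf₂_le p hp) (le_iInf₂ hpmin)
  rw [this]
  refine Or.inl ⟨Set.mem_image_of_mem _ hp, ?_⟩
  rintro _ ⟨p', hp', rfl⟩
  exact hpmin p' hp'

/-- Only ties matter. At a tie `f` is finite because `g` is never `-∞`, and the approximants
supplied by regularity also have finite `f`, so the objective converges along them. -/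
lemma biInf_errorSet_eq {W : X → Y → ℝ} {P : X → ℝ} {g : OutputThreshold Y}
    (hreg : ErrorRegular W P g) :
    ⨅ Q ∈ errorSetStrict W P g, errorObjective W P Q =
      ⨅ Q ∈ errorSet W P g, errorObjective W P Q := by
  refine le_antisymm (le_iInf₂ fun Q hQ => ?_)
    (biInf_mono fun Q hQ => ⟨hQ.1, hQ.2.le⟩)
  rcases hQ.2.lt_or_eq with hlt | heq
  · exact iInf₂_le Q ⟨hQ.1, hlt⟩
  have hb : logLik W Q ≠ ⊥ := heq ▸ g.eval_ne_bot _
  rw [errorObjective_of_ne_bot hQ.1 hb]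
  obtain ⟨u, hu, hlim⟩ := mem_closure_iff_seq_limit.1 (hreg Q hQ.1 heq)
  refine ge_of_tendsto ((continuous_coe_real_ereal.tendsto _).comp
    (((continuous_condDivReal W P).tendsto Q).comp hlim)) (Eventually.of_forall fun k => ?_)
  refine (iInf₂_le (u k) (hu k).1).trans_eq ?_
  rw [errorObjective_of_ne_bot (hu k).1.1 (hu k).2]
  rfl

/-- With `g` real and continuous on the whole simplex, `f ≤ g` is a closed condition where `f` is
finite. On a smaller domain, points with `g = +∞` could converge to points violating it. -/
lemma isMinOver_errorSet {W : X → Y → ℝ} {P : X → ℝ} {g : OutputThreshold Y}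
    (hdom : g.dom = stdSimplex ℝ Y) :
    IsMinOver (errorObjective W P) (errorSet W P g)
      (⨅ Q ∈ errorSet W P g, errorObjective W P Q) := by
  set K : Set (X × Y → ℝ) := jointWith Y P ∩ {Q | logLik W Q ≠ ⊥}
  have hKc : IsClosed K := (isClosed_jointWith P).inter (isClosed_logLik_ne_bot W)
  have hval : ContinuousOn (fun Q : X × Y → ℝ => g.val (margY Q)) K :=
    g.val_continuousOn.comp continuous_margY.continuousOn fun Q hQ => by
      rw [hdom]
      exact margY_mem_stdSimplex hQ.1
  have hcl := hKc.isClosed_le (continuous_logLikReal W).continuousOn hval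
  have hmem : ∀ Q ∈ jointWith Y P, margY Q ∈ g.dom := fun Q hQ => hdom ▸ margY_mem_stdSimplex hQ
  refine isMinOver_biInf (K := {Q ∈ K | logLikReal W Q ≤ g.val (margY Q)})
    (h := condDivReal W P) ?_
    ((isCompact_jointWith P).of_isClosed_subset hcl fun Q hQ => hQ.1.1)
    (continuous_condDivReal W P) (fun Q hQ => errorObjective_of_ne_bot hQ.1.1 hQ.1.2) ?_
  · intro Q hQ
    refine ⟨hQ.1.1, ?_⟩
    rw [logLik_of_ne_bot hQ.1.2, OutputThreshold.eval_of_mem (hmem Q hQ.1.1),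
      EReal.coe_le_coe_iff]
    exact hQ.2
  · intro Q hQ hQK
    refine errorObjective_of_eq_bot hQ.1 ?_
    by_contra hb
    refine hQK ⟨⟨hQ.1, hb⟩, ?_⟩
    have := hQ.2
    rwa [logLik_of_ne_bot hb, OutputThreshold.eval_of_mem (hmem Q hQ.1),
      EReal.coe_le_coe_iff] at this

/-- The constraint `g ≤ f` forces `Q_Y` into the compact domain, where `g` is continuous, so
closedness holds for every domain. -/
lemma isMinOver_pairsOver {W : X → Y → ℝ} {P : X → ℝ} {R : ℝ} {g : OutputThreshold Y} :
    IsMinOver (listObjective W P R) (pairsOver P (listFeasible W P g))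
      (⨅ p ∈ pairsOver P (listFeasible W P g), listObjective W P R p) := by
  set J : Set (X × Y → ℝ) := jointWith Y P ∩ {Q | logLik W Q ≠ ⊥}
  have hJc : IsClosed J := (isClosed_jointWith P).inter (isClosed_logLik_ne_bot W)
  set K : Set ((X × Y → ℝ) × (X × Y → ℝ)) :=
    (J ×ˢ J) ∩ ({p | margY p.2 ∈ g.dom} ∩ {p | margY p.2 = margY p.1})
  have hKc : IsClosed K := (hJc.prod hJc).inter
    ((g.dom_compact.isClosed.preimage (continuous_margY.comp continuous_snd)).inter
      (isClosed_eq (continuous_margY.comp continuous_snd) (continuous_margY.comp continuous_fst)))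
  have hval : ContinuousOn (fun p : (X × Y → ℝ) × (X × Y → ℝ) => g.val (margY p.2)) K :=
    g.val_continuousOn.comp (continuous_margY.comp continuous_snd).continuousOn fun p hp => hp.2.1
  have hcl := hKc.isClosed_le hval ((continuous_logLikReal W).comp continuous_snd).continuousOn
  refine isMinOver_biInf (K := {p ∈ K | g.val (margY p.2) ≤ logLikReal W p.2})
    (h := listObjectiveReal W P R) ?_
    (((isCompact_jointWith P).prod (isCompact_jointWith P)).of_isClosed_subset hcl
      fun p hp => ⟨hp.1.1.1.1, hp.1.1.2.1⟩)
    (continuous_listObjectiveReal W P R)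
    (fun p hp => listObjective_of_ne_bot hp.1.1.1.1 hp.1.1.2.1 hp.1.1.1.2) ?_
  · intro p hp
    refine ⟨hp.1.1.1.1, ⟨hp.1.1.2.1, ?_⟩, hp.1.2.2⟩
    rw [logLik_of_ne_bot hp.1.1.2.2, OutputThreshold.eval_of_mem hp.1.2.1, EReal.coe_le_coe_iff]
    exact hp.2
  · intro p hp hpK
    refine listObjective_of_eq_bot hp.1 ?_
    by_contra hb
    have hb' := logLik_ne_bot_of_mem_listFeasible hp.2.1
    have h := hp.2.1.2
    rw [logLik_of_ne_bot hb'] at h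
    have hdom : margY p.2 ∈ g.dom :=
      OutputThreshold.mem_dom_of_eval_ne_top (h.trans_lt (EReal.coe_lt_top _)).ne
    rw [OutputThreshold.eval_of_mem hdom, EReal.coe_le_coe_iff] at h
    exact hpK ⟨⟨⟨⟨hp.1, hb⟩, ⟨hp.2.1.1, hb'⟩⟩, hdom, hp.2.2⟩, h⟩

/-- A perturbation of `Q` within the joint distributions that charge only pairs with
`W(y|x) > 0` can be followed by `Q̃` when both have the same output distribution. -/
lemma exists_seq_margY_eq {W : X → Y → ℝ} {P : X → ℝ} {Q Q' : X × Y → ℝ}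
    (hQ : Q ∈ jointWith Y P) (hb : logLik W Q ≠ ⊥) (hQ' : Q' ∈ jointWith Y P)
    (hb' : logLik W Q' ≠ ⊥) (hY : margY Q' = margY Q) {u : ℕ → X × Y → ℝ}
    (hu : ∀ k, u k ∈ jointWith Y P) (hub : ∀ k, logLik W (u k) ≠ ⊥)
    (hlim : Tendsto u atTop (𝓝 Q')) :
    ∃ w : ℕ → X × Y → ℝ, Tendsto w atTop (𝓝 Q) ∧ ∀ᶠ k in atTop, w k ∈ jointWith Y P ∧
      logLik W (w k) ≠ ⊥ ∧ margY (u k) = margY (w k) := by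
  -- Chosen so that `t Q'` dominates `|u - Q'|` wherever `Q' > 0`; where `Q' = 0` the inverse is `0`
  -- and `u - Q' = u` is already nonnegative.
  set t : ℕ → ℝ := fun k => ∑ z, |u k z - Q' z| * (Q' z)⁻¹ with ht
  have htlim : Tendsto t atTop (𝓝 0) := by
    have : Tendsto t atTop (𝓝 (∑ z, |Q' z - Q' z| * (Q' z)⁻¹)) :=
      tendsto_finsetSum _ fun z _ =>
        (((tendsto_pi_nhds.1 hlim z).sub tendsto_const_nhds).abs).mul tendsto_const_nhds
    simpa using this
  have ht0 : ∀ k, 0 ≤ t k := fun k => Finset.sum_nonneg fun z _ =>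
    mul_nonneg (abs_nonneg _) (inv_nonneg.2 (hQ'.1.1 z))
  -- Mixing a little of `Q'` into `Q` makes room for the increment `u - Q'`. As `Q` and `Q'` have
  -- equal marginals, the result has those of `u`.
  refine ⟨fun k z => (1 - t k) * Q z + t k * Q' z + (u k z - Q' z), ?_, ?_⟩
  · refine tendsto_pi_nhds.2 fun z => ?_
    have := (((htlim.const_sub 1).mul_const (Q z)).add (htlim.mul_const (Q' z))).add
      ((tendsto_pi_nhds.1 hlim z).sub_const (Q' z))
    simpa using this
  · filter_upwards [htlim.eventually (gt_mem_nhds one_pos)] with k hk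
    have hsumX : ∀ x, ∑ y, ((1 - t k) * Q (x, y) + t k * Q' (x, y) + (u k (x, y) - Q' (x, y))) =
        P x := fun x => by
      have e1 : ∑ y, Q (x, y) = P x := congrFun hQ.2 x
      have e2 : ∑ y, Q' (x, y) = P x := congrFun hQ'.2 x
      have e3 : ∑ y, u k (x, y) = P x := congrFun (hu k).2 x
      rw [Finset.sum_add_distrib, Finset.sum_add_distrib, Finset.sum_sub_distrib,
        ← Finset.mul_sum, ← Finset.mul_sum, e1, e2, e3]
      ring
    refine ⟨⟨⟨fun z => ?_, ?_⟩, funext hsumX⟩, ?_, ?_⟩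
    · have h1 : 0 ≤ (1 - t k) * Q z := mul_nonneg (by linarith) (hQ.1.1 z)
      have h2 : 0 ≤ t k * Q' z + (u k z - Q' z) := by
        rcases (hQ'.1.1 z).eq_or_lt with h | h
        · rw [← h]
          simpa using (hu k).1.1 z
        · have h3 : |u k z - Q' z| * (Q' z)⁻¹ ≤ t k :=
            Finset.single_le_sum (f := fun z => |u k z - Q' z| * (Q' z)⁻¹)
              (fun z _ => mul_nonneg (abs_nonneg _) (inv_nonneg.2 (hQ'.1.1 z)))
              (Finset.mem_univ z)
          rw [← div_eq_mul_inv, div_le_iff₀ h] at h3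
          linarith [neg_abs_le (u k z - Q' z)]
      linarith
    · rw [Fintype.sum_prod_type, Finset.sum_congr rfl fun x _ => hsumX x, ← hQ.1.2,
        Fintype.sum_prod_type, ← hQ.2]
      rfl
    · rw [logLik_ne_bot_iff] at hb hb' ⊢
      intro x y hw
      have e3 := le_antisymm (logLik_ne_bot_iff.1 (hub k) x y hw) ((hu k).1.1 _)
      rw [le_antisymm (hb x y hw) (hQ.1.1 _), le_antisymm (hb' x y hw) (hQ'.1.1 _), e3]
      simp
    · funext y
      have e1 : ∑ x, Q' (x, y) = ∑ x, Q (x, y) := congrFun hY y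
      simp only [margY]
      rw [Finset.sum_add_distrib, Finset.sum_add_distrib, Finset.sum_sub_distrib,
        ← Finset.mul_sum, ← Finset.mul_sum, e1]
      ring

/-- Regularity perturbs only the second component into the strict set; `exists_seq_margY_eq` moves
the first along with it, keeping its objective finite. -/
lemma biInf_pairsOver_eq {W : X → Y → ℝ} {P : X → ℝ} {R : ℝ} {g : OutputThreshold Y}
    (hreg : ListRegular W P g) :
    ⨅ p ∈ pairsOver P (listFeasibleStrict W P g), listObjective W P R p =
      ⨅ p ∈ pairsOver P (listFeasible W P g), listObjective W P R p := by
  refine le_antisymm (le_iInf₂ fun p hp => ?_)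
    (biInf_mono fun p hp => ⟨hp.1, listFeasibleStrict_subset W P g hp.2.1, hp.2.2⟩)
  obtain ⟨hQ, hQ', hY⟩ := hp
  by_cases hb : logLik W p.1 = ⊥
  · rw [listObjective_of_eq_bot hQ hb]
    exact le_top
  rw [listObjective_of_ne_bot hQ hQ'.1 hb]
  obtain ⟨u, hu, hlim⟩ := mem_closure_iff_seq_limit.1 (hreg hQ')
  obtain ⟨w, hwlim, hw⟩ := exists_seq_margY_eq hQ hb hQ'.1
    (logLik_ne_bot_of_mem_listFeasible hQ') hY (fun k => (hu k).1)
    (fun k => logLik_ne_bot_of_mem_listFeasible (listFeasibleStrict_subset W P g (hu k))) hlim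
  refine ge_of_tendsto ((continuous_coe_real_ereal.tendsto _).comp
    (((continuous_listObjectiveReal W P R).tendsto p).comp (hwlim.prodMk_nhds hlim))) ?_
  filter_upwards [hw] with k hk
  refine (iInf₂_le (w k, u k) ⟨hk.1, hu k, hk.2.2⟩).trans_eq ?_
  exact listObjective_of_ne_bot hk.1 (hu k).1 hk.2.1

end Main

end ErasureList

end

theorem corollary1 {X Y : Type*} [Fintype X] [Fintype Y]
    (W : X → Y → ℝ) (hW : ∀ x, W x ∈ stdSimplex ℝ Y)
    (P : X → ℝ) (hP : ∃ n : ℕ, 0 < n ∧ (ErasureList.typeClass n P).Nonempty)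
    (R : ℝ) (hR : 0 < R) (g : ErasureList.OutputThreshold Y) :
    -- the error exponent
    (ErasureList.ErrorRegular W P g →
      ErasureList.errorExponent W P R (ErasureList.thresholdDecoder W g) =
        ⨅ Q ∈ ErasureList.errorSet W P g, ErasureList.errorObjective W P Q) ∧
    (ErasureList.ErrorRegular W P g → g.dom = stdSimplex ℝ Y →
      ErasureList.IsMinOver (ErasureList.errorObjective W P) (ErasureList.errorSet W P g)
        (ErasureList.errorExponent W P R (ErasureList.thresholdDecoder W g))) ∧
    -- the list size exponent
    (ErasureList.ListRegular W P g →
      ErasureList.IsMinOver (ErasureList.listObjective W P R)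
        (ErasureList.pairsOver P (ErasureList.listFeasible W P g))
        (ErasureList.listExponent W P R (ErasureList.thresholdDecoder W g))) ∧
    -- what holds without the regularity conditions
    (ErasureList.errorExponent W P R (ErasureList.thresholdDecoder W g) =
      ⨅ Q ∈ ErasureList.errorSetStrict W P g, ErasureList.errorObjective W P Q) ∧
    (⨅ p ∈ ErasureList.pairsOver P (ErasureList.listFeasible W P g),
        ErasureList.listObjective W P R p) ≤
      ErasureList.listExponent W P R (ErasureList.thresholdDecoder W g) ∧
    ErasureList.listExponent W P R (ErasureList.thresholdDecoder W g) ≤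
      ⨅ p ∈ ErasureList.pairsOver P (ErasureList.listFeasibleStrict W P g),
        ErasureList.listObjective W P R p := by
  have hW0 : ∀ x y, 0 ≤ W x y := fun x y => (hW x).1 y
  obtain ⟨n, -, hn⟩ := hP
  have hPr := ErasureList.rationalValued_of_typeClass_nonempty hn
  have hE := le_antisymm (ErasureList.errorExponent_le hW0 hPr hR g)
    (ErasureList.le_errorExponent hW0 P hR g)
  have hL1 := ErasureList.le_listExponent hW0 P hR g
  have hL2 := ErasureList.listExponent_le hW0 hPr hR g
  refine ⟨fun hreg => hE.trans (ErasureList.biInf_errorSet_eq hreg), fun hreg hdom => ?_,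
    fun hreg => ?_, hE, hL1, hL2⟩
  · rw [hE, ErasureList.biInf_errorSet_eq hreg]
    exact ErasureList.isMinOver_errorSet hdom
  · rw [le_antisymm (hL2.trans_eq (ErasureList.biInf_pairsOver_eq hreg)) hL1]
    exact ErasureList.isMinOver_pairsOver
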